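/- Let $N\ge 1$ be an integer and let $a>\max\{0,2-N\}$ be real. Put $\lambda_a=\frac{N-2}{a}$, $M=(a-1)\frac{N-2}{2}+a$ and $c_a=\left(\int_{\mathbb R^N}e^{-\frac1a|x|^a}\frac{dx}{|x|^{2-a}}\right)^{-1}$. For $\nu\in\mathbb R$ let $\check C^\nu_m(t)$ be the normalized Gegenbauer polynomials, defined by the formal expansion $\frac{1-x^2}{(1-2tx+x^2)^{\nu+1}}=\sum_{m\ge0}\check C^\nu_m(t)x^m$, let $\tilde I_\nu(w)=\sum_{k\ge0}\frac{(w/2)^{2k}}{k!\,\Gamma(\nu+k+1)}$ be the normalized $I$-Bessel function, and put $$\mathscr I(b,\nu,w,t)=\Gamma(b\nu+1)\sum_{m=0}^\infty\left(\frac w2\right)^{bm}\tilde I_{b(m+\nu)}(w)\,\check C^\nu_m(t)$$ (principal branch of the power). Let $B_a$ be the integral kernel of the $a$-generalized Fourier transform, that is, for $r,s\ge0$ and unit vectors $\omega,\mu\in\mathbb R^N$, $$B_a(r\omega,s\mu)=\mathscr I\left(\frac2a,\frac{N-2}{2},\frac{2(rs)^{a/2}}{ai},\langle\omega,\mu\rangle\right),$$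 and for $x,y\in\mathbb R^N$ and $t>0$ let $$h_a(x,y;t)=c_a\int_{\mathbb R^N}\overline{B_a(x,\xi)}\,B_a(y,\xi)\,e^{-\frac ta|\xi|^a}\frac{d\xi}{|\xi|^{2-a}}$$ be the $a$-deformed heat kernel. Then: 1. For all $x,y\in\mathbb R^N$ and $t>0$ the integral defining $h_a(x,y;t)$ converges absolutely, $h_a(x,y;t)$ is real, and $h_a(x,y;t)=h_a(y,x;t)$. 2. There is a constant $C>0$, depending only on $N$ and $a$, such that for all $x,y\in\mathbb R^N$ and $t>0$, with $r=|x|$ and $s=|y|$, $$|h_a(x,y;t)|\le C\,t^{-(\lambda_a+1)}\,e^{-\frac{(r^{a/2}-s^{a/2})^2}{at}}\left(1+\left(\frac{(rs)^{a/2}}{at}\right)^{\frac{2M}{a}}\right).$$ (If $rs=0$ and $M<0$, the power $0^{2M/a}$ is read as $0$, which only strengthens the bound.) -/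

import Mathlib

open MeasureTheory

noncomputable section

namespace DeformedHeat

/-- The normalized Gegenbauer polynomial `Č_m^ν(t)`: the coefficient of `x ^ m` in the formal
expansion of `(1 - x²) / (1 - 2 t x + x²) ^ (ν + 1)`. The real power
`(1 - 2 t x + x²) ^ (-(ν + 1))` is the binomial series `(1 + y) ^ (-(ν + 1))` at
`y = x² - 2 t x`. -/
def normGegenbauer (ν : ℝ) (m : ℕ) (t : ℝ) : ℝ :=
  PowerSeries.coeff m
    ((1 - PowerSeries.X ^ 2) *
      (PowerSeries.binomialSeries ℝ (-(ν + 1))).subst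
        (PowerSeries.X ^ 2 - PowerSeries.C (2 * t) * PowerSeries.X : PowerSeries ℝ))

/-- The normalized I-Bessel function
`Ĩ_ν(w) = ∑ k, (w / 2) ^ (2 k) / (k ! Γ(ν + k + 1))`.
(`Real.Gamma` is `0` at its poles, so the terms there are `0`, as they should be.) -/
def normBesselI (ν : ℝ) (w : ℂ) : ℂ :=
  ∑' k : ℕ, (w / 2) ^ (2 * k) / ((k.factorial : ℂ) * (Real.Gamma (ν + k + 1) : ℂ))

/-- The function
`𝓘(b, ν, w, t) = Γ(b ν + 1) ∑ m, (w / 2) ^ (b m) Ĩ_{b (m + ν)}(w) Č_m^ν(t)`,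
with the principal branch of `(w / 2) ^ (b m)`. -/
def scrI (b ν : ℝ) (w : ℂ) (t : ℝ) : ℂ :=
  (Real.Gamma (b * ν + 1) : ℂ) *
    ∑' m : ℕ, (w / 2) ^ ((b * m : ℝ) : ℂ) * normBesselI (b * (m + ν)) w *
      (normGegenbauer ν m t : ℂ)

/-- `λ_a = (N - 2) / a`. -/
def lam (N : ℕ) (a : ℝ) : ℝ := ((N : ℝ) - 2) / a

/-- `M = (a - 1) (N - 2) / 2 + a`. -/
def bigM (N : ℕ) (a : ℝ) : ℝ := (a - 1) * (((N : ℝ) - 2) / 2) + a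

/-- The normalizing constant `c_a = (∫ exp (-|x| ^ a / a) |x| ^ (a - 2) dx)⁻¹`. -/
def cConst (N : ℕ) (a : ℝ) : ℝ :=
  (∫ x : EuclideanSpace ℝ (Fin N), Real.exp (-(1 / a) * ‖x‖ ^ a) * ‖x‖ ^ (a - 2))⁻¹

/-- The integral kernel of the `a`-generalized Fourier transform:
`B_a(r ω, s μ) = 𝓘(2 / a, (N - 2) / 2, 2 (r s) ^ (a / 2) / (a i), ⟨ω, μ⟩)`.
Here `⟨ω, μ⟩ = ⟨x, y⟩ / (|x| |y|)`; if `x = 0` or `y = 0`, then `w = 0`, only the term `m = 0` of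
the series for `𝓘` survives, and the value does not depend on `⟨ω, μ⟩`. -/
def fourierKernel (N : ℕ) (a : ℝ) (x y : EuclideanSpace ℝ (Fin N)) : ℂ :=
  scrI (2 / a) (((N : ℝ) - 2) / 2)
    (2 * (((‖x‖ * ‖y‖) ^ (a / 2) : ℝ) : ℂ) / ((a : ℂ) * Complex.I))
    (inner ℝ x y / (‖x‖ * ‖y‖))

/-- The integrand of the `a`-deformed heat kernel, with respect to Lebesgue measure `dξ`:
`conj B_a(x, ξ) · B_a(y, ξ) · exp (-(t / a) |ξ| ^ a) · |ξ| ^ (a - 2)`. -/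
def heatIntegrand (N : ℕ) (a : ℝ) (x y : EuclideanSpace ℝ (Fin N)) (t : ℝ)
    (ξ : EuclideanSpace ℝ (Fin N)) : ℂ :=
  (starRingEnd ℂ) (fourierKernel N a x ξ) * fourierKernel N a y ξ *
    ((Real.exp (-(t / a) * ‖ξ‖ ^ a) * ‖ξ‖ ^ (a - 2) : ℝ) : ℂ)

/-- The `a`-deformed heat kernel
`h_a(x, y; t) = c_a ∫ conj B_a(x, ξ) B_a(y, ξ) exp (-(t / a) |ξ| ^ a) dξ / |ξ| ^ (2 - a)`. -/
def heatKernel (N : ℕ) (a : ℝ) (x y : EuclideanSpace ℝ (Fin N)) (t : ℝ) : ℂ :=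
  (cConst N a : ℂ) * ∫ ξ : EuclideanSpace ℝ (Fin N), heatIntegrand N a x y t ξ

end DeformedHeat

end

/-! Put `b = 2 / a`, `ν = (N - 2) / 2`, `l = b ν = λ_a` and `v = (r s) ^ (a / 2) / (a t)`. Each
kernel `B_a` is expanded into a double series over the Gegenbauer degree and the Bessel index, and
the product of the two series is integrated term by term in polar coordinates. On the sphere the
normalized Gegenbauer polynomials are reproducing kernels (`sphereMean_gegenbauer_mul_gegenbauer`),
so only equal degrees survive, and there the phases `(-i) ^ (b m)` cancel against their conjugates.
The radial integrals are Gamma integrals, and their sum over the two Bessel indices is Weber's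
second exponential integral (`hasSum_weber`). Up to a constant depending only on `N` and `a`, the
integral equals `t ^ (-(l + 1)) exp (-(r ^ a + s ^ a) / (a t)) ∑ m, v ^ (b m) Ĩ_{b m + l}(2 v)
Č_m(⟨ω, μ⟩)`, a real series. Reality and conjugation under the exchange of `x` and `y` give
symmetry.

The bound is obtained term by term. Positivity of the reproducing kernel and the generating function
at `1` give `|Č_m| ≤ Č_m(1) ≤ 2 (m + 1) ^ (N - 2)`. The Bessel factor decays in its order: for `v ≥
1`, `v ^ μ Ĩ_μ(2 v) (μ + 1) ^ N` is at most a constant times `exp (2 v) v ^ N`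
(`rpow_mul_besselSum_mul_pow_le`). These `N` powers leave the summable factor `(m + 1) ^ (-2)`, at
the price of `v ^ (N - l) = v ^ (2 M / a)`, while `exp (2 v)` completes the square in the exponent.

Termwise integration and absolute convergence rest on the cruder bound `|B_a| ≤ K exp (3 V)` with `V
= r ^ (a / 2) |ξ| ^ (a / 2) / a`, valid also for the sum of the norms of the terms, which the factor
`exp (-(t / a) |ξ| ^ a)` beats. Orthogonality on the sphere is proved from moments: Gaussian
integrals give the moments, polarization gives the mixed ones, and finite differences and partial
fractions evaluate the remaining sums. -/

noncomputable section

namespace DeformedHeat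

/-! ### Explicit coefficients of the normalized Gegenbauer polynomials. -/

/-- The rising factorial `(ν + 1) (ν + 2) ⋯ (ν + k)`. -/
def rising (ν : ℝ) (k : ℕ) : ℝ := (ascPochhammer ℝ k).eval (ν + 1)

theorem rising_zero (ν : ℝ) : rising ν 0 = 1 := by simp [rising]

theorem rising_succ (ν : ℝ) (k : ℕ) : rising ν (k + 1) = rising ν k * (ν + 1 + k) := by
  simp [rising, ascPochhammer_succ_eval]

theorem rising_pos {ν : ℝ} (hν : -1 < ν) (k : ℕ) : 0 < rising ν k := by
  induction k with
  | zero => simp [rising_zero]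
  | succ k ih =>
    rw [rising_succ]
    have : (0 : ℝ) ≤ k := k.cast_nonneg
    exact mul_pos ih (by linarith)

theorem choose_neg_eq_rising (ν : ℝ) (k : ℕ) :
    Ring.choose (-(ν + 1)) k = (-1) ^ k * rising ν k / k.factorial := by
  have h1 := Ring.factorial_nsmul_multichoose_eq_ascPochhammer (ν + 1) k
  have h2 : (k.factorial : ℝ) ≠ 0 := by positivity
  rw [Ring.choose_neg', rising, ← Polynomial.ascPochhammer_smeval_eq_eval, ← h1]
  rw [nsmul_eq_mul, Units.smul_def, zsmul_eq_mul, Int.cast_negOnePow_natCast]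
  field_simp

/-- The series whose coefficients are the (unnormalized) Gegenbauer polynomials of index `ν + 1`. -/
def gegenbauerSeries (ν t : ℝ) : PowerSeries ℝ :=
  (PowerSeries.binomialSeries ℝ (-(ν + 1))).subst
        (PowerSeries.X ^ 2 - PowerSeries.C (2 * t) * PowerSeries.X : PowerSeries ℝ)

theorem hasSubst_quadratic (t : ℝ) : PowerSeries.HasSubst
    (PowerSeries.X ^ 2 - PowerSeries.C (2 * t) * PowerSeries.X : PowerSeries ℝ) :=
  PowerSeries.HasSubst.of_constantCoeff_zero' (by simp)

/-- The base factors as `(X - 2 t) X`, so the coefficient is read off the binomial theorem after a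
shift by `k`. -/
theorem coeff_quadratic_pow (t : ℝ) (m k : ℕ) :
    PowerSeries.coeff m
      ((PowerSeries.X ^ 2 - PowerSeries.C (2 * t) * PowerSeries.X : PowerSeries ℝ) ^ k) =
      if k ≤ m then (-(2 * t)) ^ (k - (m - k)) * (k.choose (m - k) : ℝ) else 0 := by
  have h : (PowerSeries.X ^ 2 - PowerSeries.C (2 * t) * PowerSeries.X : PowerSeries ℝ) ^ k =
      (((Polynomial.X + Polynomial.C (-(2 * t))) ^ k : Polynomial ℝ) : PowerSeries ℝ) *
        PowerSeries.X ^ k := by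
    push_cast
    rw [← mul_pow]
    congr 1
    simp
    ring
  rw [h, PowerSeries.coeff_mul_X_pow']
  split_ifs with hk
  · rw [Polynomial.coeff_coe, Polynomial.coeff_X_add_C_pow]
  · rfl

theorem coeff_gegenbauerSeries (ν t : ℝ) (m : ℕ) :
    PowerSeries.coeff m (gegenbauerSeries ν t) =
      ∑ j ∈ Finset.range (m / 2 + 1), (-1) ^ j * 2 ^ (m - 2 * j) * rising ν (m - j) /
        (j.factorial * (m - 2 * j).factorial) * t ^ (m - 2 * j) := by
  rw [gegenbauerSeries, PowerSeries.coeff_subst' (hasSubst_quadratic t),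
    finsum_eq_sum_of_support_subset (s := Finset.range (m + 1))]
  swap
  · intro k hk
    simp only [Function.mem_support] at hk
    by_contra h
    simp only [Finset.coe_range, Set.mem_Iio, not_lt] at h
    apply hk
    rw [coeff_quadratic_pow, if_neg (by omega), smul_zero]
  -- The reflection substitutes `k = m - j`; terms with `2 j > m` vanish through the binomial
  -- coefficient.
  rw [← Finset.sum_range_reflect]
  symm
  apply Finset.sum_subset_zero_on_sdiff
  · intro j hj
    simp only [Finset.mem_range] at hj ⊢
    omega
  · intro j hj
    simp only [Finset.mem_sdiff, Finset.mem_range] at hj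
    rw [coeff_quadratic_pow, if_pos (by omega), Nat.choose_eq_zero_of_lt (by omega)]
    simp
  · intro j hj
    simp only [Finset.mem_range] at hj
    have h2 : 2 * j ≤ m := by omega
    obtain ⟨l, rfl⟩ := Nat.exists_eq_add_of_le h2
    rw [coeff_quadratic_pow, if_pos (by omega), PowerSeries.binomialSeries_coeff,
      choose_neg_eq_rising]
    have e1 : 2 * j + l + 1 - 1 - j = j + l := by omega
    have e2 : 2 * j + l - 2 * j = l := by omega
    have e3 : 2 * j + l - j = j + l := by omega
    have e4 : 2 * j + l - (j + l) = j := by omega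
    have e5 : j + l - j = l := by omega
    rw [e1, e2, e3, e4, e5]
    have hc : ((j + l).choose j : ℝ) * (j.factorial * l.factorial) = (j + l).factorial := by
      have := Nat.choose_mul_factorial_mul_factorial (Nat.le_add_right j l)
      rw [e5] at this
      rw [← this]; push_cast; ring
    rw [← hc]
    have f1 : (j.factorial : ℝ) ≠ 0 := by positivity
    have f2 : (l.factorial : ℝ) ≠ 0 := by positivity
    have f3 : ((j + l).choose j : ℝ) ≠ 0 := by
      exact_mod_cast (Nat.choose_pos (Nat.le_add_right j l)).ne'
    simp only [smul_eq_mul, mul_one]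
    rw [show (-(2 * t)) = (-1) * 2 * t by ring, mul_pow, mul_pow, pow_add (-1 : ℝ) j l]
    have h1 : (-1 : ℝ) ^ l * (-1) ^ l = 1 := by rw [← mul_pow]; simp
    field_simp
    linear_combination (-(rising ν (j + l) * t ^ l)) * h1

/-- The coefficient of `t ^ (m - 2 j)` in the normalized Gegenbauer polynomial. -/
def gegenbauerCoeff (ν : ℝ) (m j : ℕ) : ℝ :=
  if m = 0 then 1 else (-1) ^ j * 2 ^ (m - 2 * j) * (m + ν) * rising ν (m - j - 1) /
        (j.factorial * (m - 2 * j).factorial)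

theorem normGegenbauer_zero (ν t : ℝ) : normGegenbauer ν 0 t = 1 := by
  have := coeff_gegenbauerSeries ν t 0
  simp [rising_zero] at this
  simp only [normGegenbauer]
  rw [← gegenbauerSeries]
  simp [this]

theorem normGegenbauer_one (ν t : ℝ) : normGegenbauer ν 1 t = 2 * (1 + ν) * t := by
  have := coeff_gegenbauerSeries ν t 1
  simp [rising_zero, rising_succ] at this
  simp only [normGegenbauer]
  rw [← gegenbauerSeries, sub_mul, map_sub, PowerSeries.coeff_X_pow_mul', one_mul, this]
  simp only [Nat.not_ofNat_le_one, if_false, sub_zero]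
  ring

/-- Multiplication by `1 - X ^ 2` subtracts the coefficient two degrees lower. After a shift of `j`
the two terms share a rising factorial, and the remaining factors `ν + m - j` and `j` add up to `m +
ν`. -/
theorem normGegenbauer_eq_sum (ν t : ℝ) (m : ℕ) :
    normGegenbauer ν m t =
      ∑ j ∈ Finset.range (m / 2 + 1), gegenbauerCoeff ν m j * t ^ (m - 2 * j) := by
  -- The factor `X ^ 2` acts only from degree two on. Degree zero is exceptional also because `m - j
  -- - 1` truncates: the general formula would give `ν` instead of `1`.
  rcases m with _ | _ | m
  · simp [normGegenbauer_zero, gegenbauerCoeff]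
  · simp [normGegenbauer_one, gegenbauerCoeff, rising_zero]
  · simp only [normGegenbauer]
    rw [← gegenbauerSeries, sub_mul, map_sub, PowerSeries.coeff_X_pow_mul', one_mul,
      if_pos (by omega), coeff_gegenbauerSeries, coeff_gegenbauerSeries]
    have e : (m + 1 + 1) / 2 + 1 = (m / 2 + 1) + 1 := by omega
    have e' : m + 1 + 1 - 2 = m := by omega
    rw [e, e', Finset.sum_range_succ' _ (m / 2 + 1), Finset.sum_range_succ' _ (m / 2 + 1), add_sub_right_comm,
      ← Finset.sum_sub_distrib]
    congr 1
    · apply Finset.sum_congr rfl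
      intro j hj
      simp only [Finset.mem_range] at hj
      obtain ⟨l, hl⟩ := Nat.exists_eq_add_of_le (show 2 * j ≤ m by omega)
      have e2 : m + 1 + 1 - 2 * (j + 1) = l := by omega
      have e3 : m - 2 * j = l := by omega
      have e4 : m + 1 + 1 - (j + 1) = (j + l) + 1 := by omega
      have e5 : m - j = j + l := by omega
      have e6 : j + l + 1 - 1 = j + l := by omega
      rw [gegenbauerCoeff, if_neg (by omega), e2, e3, e4, e5, e6, rising_succ, hl,
        Nat.factorial_succ, pow_succ]
      push_cast
      have f1 : (j.factorial : ℝ) ≠ 0 := by positivity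
      have f2 : (l.factorial : ℝ) ≠ 0 := by positivity
      field_simp
      ring
    · rw [gegenbauerCoeff, if_neg (by omega)]
      have e4 : m + 1 + 1 - 0 = m + 1 + 1 := by omega
      have e5 : m + 1 + 1 - 1 = m + 1 := by omega
      rw [e4, e5, rising_succ ν (m + 1)]
      push_cast
      field_simp
      ring

/-! ### Alternating binomial sums. -/

/-- `∑ (-1) ^ j (q choose j) P (j) = 0` when `P` has degree less than `q`. -/
theorem alternating_sum_polynomial (P : Polynomial ℝ) {q : ℕ} (h : P.natDegree < q) :
    ∑ j ∈ Finset.range (q + 1), (-1 : ℝ) ^ j * (q.choose j : ℝ) * P.eval (j : ℝ) = 0 := by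
  have h1 := congrFun (Polynomial.fwdDiff_iter_eq_zero_of_degree_lt h) 0
  rw [fwdDiff_iter_eq_sum_shift] at h1
  simp only [zero_add, nsmul_eq_mul, mul_one, zsmul_eq_mul, Pi.zero_apply] at h1
  rw [← mul_right_inj' (show ((-1 : ℝ) ^ q) ≠ 0 by simp), mul_zero, ← h1, Finset.mul_sum]
  apply Finset.sum_congr rfl
  intro j hj
  simp only [Finset.mem_range] at hj
  obtain ⟨l, rfl⟩ := Nat.exists_eq_add_of_le (show j ≤ q by omega)
  have : j + l - j = l := by omega
  rw [this]
  push_cast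
  rw [pow_add]
  have h1 : (-1 : ℝ) ^ j * (-1) ^ j = 1 := by rw [← mul_pow]; simp
  linear_combination ((-1 : ℝ) ^ l * ((j + l).choose j : ℝ) * P.eval (j : ℝ)) * h1

/-- Partial fractions: the alternating binomial sum of `1 / (x - j)`. -/
theorem alternating_sum_inv (q : ℕ) (x : ℝ) (hx : ∀ j ≤ q, x - j ≠ 0) :
    ∑ j ∈ Finset.range (q + 1), (-1 : ℝ) ^ j * (q.choose j : ℝ) * (x - j)⁻¹ =
      (-1) ^ q * q.factorial * (∏ i ∈ Finset.range (q + 1), (x - i))⁻¹ := by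
  induction q generalizing x with
  | zero => simp
  | succ q ih =>
    -- Pascal's rule writes the sum of order `q + 1` at `x` as the difference of the sums of order
    -- `q` at `x` and at `x - 1`.
    have key : ∑ j ∈ Finset.range (q + 1 + 1), (-1 : ℝ) ^ j * ((q + 1).choose j : ℝ) * (x - j)⁻¹ =
        ∑ j ∈ Finset.range (q + 1), (-1 : ℝ) ^ j * (q.choose j : ℝ) * (x - j)⁻¹ -
        ∑ j ∈ Finset.range (q + 1), (-1 : ℝ) ^ j * (q.choose j : ℝ) * (x - 1 - j)⁻¹ := by
      rw [Finset.sum_range_succ' _ (q + 1)]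
      have : ∑ j ∈ Finset.range (q + 1), (-1 : ℝ) ^ j * (q.choose j : ℝ) * (x - j)⁻¹ =
          ∑ j ∈ Finset.range (q + 1 + 1), (-1 : ℝ) ^ j * (q.choose j : ℝ) * (x - j)⁻¹ := by
        rw [Finset.sum_range_succ _ (q + 1)]; simp
      rw [this, Finset.sum_range_succ' _ (q + 1), add_sub_right_comm, ← Finset.sum_sub_distrib]
      congr 1
      · apply Finset.sum_congr rfl
        intro j _
        rw [Nat.choose_succ_succ]
        push_cast
        rw [show x - 1 - (j : ℝ) = x - (j + 1) by ring]
        ring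
      · simp
    rw [key, ih x (fun j hj => hx j (by omega)), ih (x - 1) (fun j hj => by
      have := hx (j + 1) (by omega); push_cast at this; rwa [sub_sub, add_comm])]
    have h0 := hx 0 (by omega)
    have hl := hx (q + 1) le_rfl
    set Q := ∏ i ∈ Finset.range q, (x - (i + 1 : ℝ)) with hQ
    have hQ0 : Q ≠ 0 := Finset.prod_ne_zero_iff.2 fun i hi => by
      have := hx (i + 1) (by simp at hi; omega); push_cast at this; exact this
    have p1 : ∏ i ∈ Finset.range (q + 1), (x - i) = Q * x := by
      rw [Finset.prod_range_succ']; simp [hQ]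
    have p2 : ∏ i ∈ Finset.range (q + 1), (x - 1 - i) = Q * (x - (q + 1)) := by
      rw [Finset.prod_range_succ, hQ]
      congr 1
      · exact Finset.prod_congr rfl fun i _ => by ring
      · ring
    have p3 : ∏ i ∈ Finset.range (q + 1 + 1), (x - i) = Q * x * (x - (q + 1)) := by
      rw [Finset.prod_range_succ, p1]; push_cast; ring
    rw [p1, p2, p3, Nat.factorial_succ]
    push_cast at h0 hl ⊢
    rw [sub_zero] at h0
    field_simp
    ring

/-! ### Pairing Gegenbauer polynomials with powers, from the moments alone. -/

section

/-- In the binomial expansion of `1 + (X + 2 t) X`, the index `u` counts the factors `1`; then `i +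
u - K` factors are `X ^ 2` and `n - 2 u` are `2 t X`. -/
theorem coeff_trinomial_pow (t : ℝ) {i n K : ℕ} (h : i + n = 2 * K) :
    ((Polynomial.X ^ 2 + Polynomial.C (2 * t) * Polynomial.X + 1 : Polynomial ℝ) ^ K).coeff i =
      ∑ u ∈ Finset.range (n / 2 + 1), if K ≤ i + u then
        (K.factorial : ℝ) / (u.factorial * (i + u - K).factorial * (n - 2 * u).factorial) *
          (2 * t) ^ (n - 2 * u) else 0 := by
  have h1 : (Polynomial.X ^ 2 + Polynomial.C (2 * t) * Polynomial.X + 1 : Polynomial ℝ) =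
      1 + (Polynomial.X + Polynomial.C (2 * t)) * Polynomial.X := by ring
  rw [h1, add_pow, Polynomial.finsetSum_coeff]
  symm
  apply Finset.sum_subset_zero_on_sdiff
  · intro u hu
    simp only [Finset.mem_range] at hu ⊢
    omega
  · intro u hu
    simp only [Finset.mem_sdiff, Finset.mem_range] at hu
    rw [one_pow, one_mul, mul_comm _ ((K.choose u : ℕ) : Polynomial ℝ), ← Polynomial.C_eq_natCast,
      Polynomial.coeff_C_mul, mul_pow (Polynomial.X + Polynomial.C (2 * t)),
      Polynomial.coeff_mul_X_pow', if_pos (by omega), Polynomial.coeff_X_add_C_pow,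
      Nat.choose_eq_zero_of_lt (show K - u < i - (K - u) by omega)]
    simp
  · intro u hu
    simp only [Finset.mem_range] at hu
    rw [one_pow, one_mul, mul_comm _ ((K.choose u : ℕ) : Polynomial ℝ), ← Polynomial.C_eq_natCast,
      Polynomial.coeff_C_mul, mul_pow (Polynomial.X + Polynomial.C (2 * t)),
      Polynomial.coeff_mul_X_pow']
    by_cases hc : K ≤ i + u
    · rw [if_pos hc, if_pos (by omega), Polynomial.coeff_X_add_C_pow]
      obtain ⟨v, hv⟩ := Nat.exists_eq_add_of_le hc
      obtain ⟨l, hl⟩ := Nat.exists_eq_add_of_le (show 2 * u ≤ n by omega)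
      have e0 : K = u + (v + l) := by omega
      have e1 : i + u - K = v := by omega
      have e2 : n - 2 * u = l := by omega
      have e3 : K - u = v + l := by omega
      have e4 : i - (v + l) = v := by omega
      have e5 : v + l - v = l := by omega
      have e6 : u + (v + l) - u = v + l := by omega
      rw [e1, e2, e3, e4, e5]
      have c1 := Nat.choose_mul_factorial_mul_factorial (show u ≤ K by omega)
      have c2 := Nat.choose_mul_factorial_mul_factorial (Nat.le_add_right v l)
      rw [e3] at c1
      rw [e5] at c2
      have c3 : (K.factorial : ℝ) = (K.choose u) * u.factorial *
          ((v + l).choose v * v.factorial * l.factorial) := by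
        rw [← c1, ← c2]; push_cast; ring
      rw [c3]
      field_simp
    · rw [if_neg hc, if_neg (by omega), mul_zero]

/-- The moments `∫ ⟨ω, η⟩ ^ (2 K) dσ(η)` of the uniform probability measure on the unit sphere of
dimension `2 ν + 1`. -/
def sphereMoment (ν : ℝ) (K : ℕ) : ℝ :=
  ((2 * K).factorial : ℝ) / (4 ^ K * K.factorial * rising ν K)

variable {ν t : ℝ} {A : ℕ → ℕ → ℝ}

/-- Here `A i n` stands for the mean of `⟨ω, η⟩ ^ i ⟨u, η⟩ ^ n` with `t = ⟨ω, u⟩`. Keeping `A`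
abstract separates the combinatorics from the measure theory. -/
theorem mixed_moment_eq
    (heven : ∀ i n K, i + n = 2 * K → ((2 * K).choose i : ℝ) * A i n = sphereMoment ν K *
      ((Polynomial.X ^ 2 + Polynomial.C (2 * t) * Polynomial.X + 1 : Polynomial ℝ) ^ K).coeff i)
    {i n K : ℕ} (h : i + n = 2 * K) :
    A i n = ∑ u ∈ Finset.range (n / 2 + 1), if K ≤ i + u then
        (i.factorial : ℝ) * n.factorial / (4 ^ K * rising ν K *
          (u.factorial * (i + u - K).factorial * (n - 2 * u).factorial)) *
          (2 * t) ^ (n - 2 * u) else 0 := by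
  have h1 := heven i n K h
  rw [coeff_trinomial_pow t h] at h1
  have c1 := Nat.choose_mul_factorial_mul_factorial (show i ≤ 2 * K by omega)
  rw [show 2 * K - i = n by omega] at c1
  have hc : ((2 * K).choose i : ℝ) ≠ 0 := by
    exact_mod_cast (Nat.choose_pos (show i ≤ 2 * K by omega)).ne'
  rw [← mul_right_inj' hc, h1, sphereMoment, ← c1, Finset.mul_sum, Finset.mul_sum]
  apply Finset.sum_congr rfl
  intro u _
  split_ifs
  · push_cast
    field_simp
  · simp

theorem rising_ratio (hν : -1 < ν) (k e : ℕ) :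
    rising ν (k + e) / rising ν k = ∏ i ∈ Finset.range e, (ν + 1 + k + i) := by
  induction e with
  | zero => simp [(rising_pos hν k).ne']
  | succ e ih =>
    rw [Finset.prod_range_succ, ← ih, ← add_assoc, rising_succ]
    push_cast
    ring

/-- For `d ≥ 1` the ratio is a polynomial in `j` of degree `d - 1 < q`, and a `q`-th finite
difference annihilates it. -/
theorem alternating_sum_rising (hν : -1 < ν) {m d q : ℕ} (hd : 1 ≤ d) (hq : d ≤ q)
    (hm : q + d ≤ m) :
    ∑ j ∈ Finset.range (q + 1), (-1 : ℝ) ^ j * (q.choose j : ℝ) *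
      (rising ν (m - j - 1) / rising ν (m - j - d)) = 0 := by
  have hdeg : (∏ i ∈ Finset.range (d - 1),
      (Polynomial.C (ν + 1 + m - d + i) - Polynomial.X : Polynomial ℝ)).natDegree < q := by
    refine lt_of_le_of_lt (Polynomial.natDegree_prod_le _ _) ?_
    refine lt_of_le_of_lt (Finset.sum_le_card_nsmul _ _ 1 fun i _ => ?_) ?_
    · exact (Polynomial.natDegree_sub_le _ _).trans
        (max_le ((Polynomial.natDegree_C _).le.trans zero_le_one) Polynomial.natDegree_X_le)
    · simp; omega
  rw [← alternating_sum_polynomial _ hdeg]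
  apply Finset.sum_congr rfl
  intro j hj
  simp only [Finset.mem_range] at hj
  congr 1
  rw [Polynomial.eval_prod, show m - j - 1 = (m - j - d) + (d - 1) by omega, rising_ratio hν]
  apply Finset.prod_congr rfl
  intro i _
  rw [Nat.cast_sub (by omega), Nat.cast_sub (by omega)]
  simp
  ring

/-- This is the case `d = 0`: the ratio is `1 / (ν + m - j)`, which is summed by partial fractions
instead. -/
theorem alternating_sum_rising_inv (hν : -1 < ν) {m u : ℕ} (hu : u + 1 ≤ m) :
    ∑ j ∈ Finset.range (u + 1), (-1 : ℝ) ^ j * (u.choose j : ℝ) *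
      (rising ν (m - j - 1) / rising ν (m - j)) =
      (-1) ^ u * u.factorial * (rising ν (m - u - 1) / rising ν m) := by
  have hpos : ∀ j ≤ u, ν + m - j ≠ 0 := by
    intro j hj
    have : (j : ℝ) + 1 ≤ m := by exact_mod_cast (show j + 1 ≤ m by omega)
    apply ne_of_gt
    linarith
  have h1 := alternating_sum_inv u (ν + m) hpos
  have e1 : rising ν (m - u - 1) / rising ν m =
      (∏ i ∈ Finset.range (u + 1), (ν + m - i))⁻¹ := by
    have := rising_ratio hν (m - u - 1) (u + 1)
    rw [show m - u - 1 + (u + 1) = m by omega] at this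
    rw [← inv_div, this, ← Finset.prod_range_reflect]
    congr 1
    apply Finset.prod_congr rfl
    intro i hi
    simp only [Finset.mem_range] at hi
    rw [Nat.cast_sub (by omega), Nat.cast_sub (by omega), Nat.cast_sub (by omega),
      Nat.cast_sub (by omega)]
    push_cast
    ring
  rw [e1, ← h1]
  apply Finset.sum_congr rfl
  intro j hj
  simp only [Finset.mem_range] at hj
  congr 1
  have := rising_succ ν (m - j - 1)
  rw [show m - j - 1 + 1 = m - j by omega] at this
  have hne := (rising_pos hν (m - j - 1)).ne'
  have hne' := hpos j (by omega)
  rw [this, Nat.cast_sub (by omega), Nat.cast_sub (by omega)]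
  push_cast
  rw [show ν + 1 + ((m : ℝ) - j - 1) = ν + m - j by ring]
  field_simp

/-- After the two sums are interchanged, the factorials of `j` and `u + d - j` combine into a
binomial coefficient, and the inner sum over `j` is an alternating one: zero for `d ≥ 1` and
explicit for `d = 0`. -/
theorem gegenbauer_pairing_inner
    (heven : ∀ i n K, i + n = 2 * K → ((2 * K).choose i : ℝ) * A i n = sphereMoment ν K *
      ((Polynomial.X ^ 2 + Polynomial.C (2 * t) * Polynomial.X + 1 : Polynomial ℝ) ^ K).coeff i)
    (hν : -1 < ν) {m n d : ℕ} (hm : m ≠ 0) (hd : n + 2 * d = m) :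
    ∑ j ∈ Finset.range (m / 2 + 1), gegenbauerCoeff ν m j * A (m - 2 * j) n =
      ∑ u ∈ Finset.range (n / 2 + 1), (n.factorial * (m + ν) * (2 * t) ^ (n - 2 * u) /
        (2 ^ n * u.factorial * (n - 2 * u).factorial * (u + d).factorial)) *
        ∑ j ∈ Finset.range (u + d + 1), (-1 : ℝ) ^ j * ((u + d).choose j : ℝ) *
          (rising ν (m - j - 1) / rising ν (m - j - d)) := by
  have h1 : ∀ j ∈ Finset.range (m / 2 + 1), gegenbauerCoeff ν m j * A (m - 2 * j) n =
      ∑ u ∈ Finset.range (n / 2 + 1), if j ≤ u + d then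
        (n.factorial * (m + ν) * (2 * t) ^ (n - 2 * u) /
        (2 ^ n * u.factorial * (n - 2 * u).factorial * (u + d).factorial)) *
        ((-1 : ℝ) ^ j * ((u + d).choose j : ℝ) *
          (rising ν (m - j - 1) / rising ν (m - j - d))) else 0 := by
    intro j hj
    by_cases hjd : m < j + d
    · simp only [Finset.mem_range] at hj
      omega
    simp only [Finset.mem_range] at hj
    rw [mixed_moment_eq heven (show m - 2 * j + n = 2 * (m - j - d) by omega), Finset.mul_sum]
    apply Finset.sum_congr rfl
    intro u hu
    simp only [Finset.mem_range] at hu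
    by_cases hc : j ≤ u + d
    · rw [if_pos hc, if_pos (by omega), gegenbauerCoeff, if_neg hm,
        show m - 2 * j + u - (m - j - d) = u + d - j by omega]
      have c1 := Nat.choose_mul_factorial_mul_factorial hc
      have hr := (rising_pos hν (m - j - d)).ne'
      have e2 : (2 : ℝ) ^ (m - 2 * j) * 2 ^ n = 4 ^ (m - j - d) := by
        rw [← pow_add, show (4 : ℝ) = 2 ^ 2 by norm_num, ← pow_mul]
        congr 1
        omega
      have hc0 : ((u + d).choose j : ℝ) ≠ 0 := by exact_mod_cast (Nat.choose_pos hc).ne'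
      rw [← c1, ← e2]
      push_cast
      field_simp
    · rw [if_neg hc, if_neg (by omega), mul_zero]
  rw [Finset.sum_congr rfl h1, Finset.sum_comm]
  apply Finset.sum_congr rfl
  intro u hu
  simp only [Finset.mem_range] at hu
  rw [Finset.mul_sum]
  symm
  apply Finset.sum_subset_zero_on_sdiff
  · intro j hj
    simp only [Finset.mem_range] at hj ⊢
    omega
  · intro j hj
    simp only [Finset.mem_sdiff, Finset.mem_range] at hj
    rw [if_neg (by omega)]
  · intro j hj
    simp only [Finset.mem_range] at hj
    rw [if_pos (by omega)]

/-- The Gegenbauer polynomial of degree `m` is orthogonal to powers of lower degree. -/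
theorem gegenbauer_pairing_lt
    (hodd : ∀ i n, Odd (i + n) → A i n = 0)
    (heven : ∀ i n K, i + n = 2 * K → ((2 * K).choose i : ℝ) * A i n = sphereMoment ν K *
      ((Polynomial.X ^ 2 + Polynomial.C (2 * t) * Polynomial.X + 1 : Polynomial ℝ) ^ K).coeff i)
    (hν : -1 < ν) {m n : ℕ} (hn : n < m) :
    ∑ j ∈ Finset.range (m / 2 + 1), gegenbauerCoeff ν m j * A (m - 2 * j) n = 0 := by
  rcases Nat.even_or_odd (m + n) with he | ho
  · obtain ⟨c, hc⟩ := he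
    obtain ⟨d, hd⟩ : ∃ d, n + 2 * d = m := ⟨c - n, by omega⟩
    rw [gegenbauer_pairing_inner heven hν (by omega) hd]
    apply Finset.sum_eq_zero
    intro u hu
    simp only [Finset.mem_range] at hu
    rw [alternating_sum_rising hν (by omega) (by omega) (by omega), mul_zero]
  · apply Finset.sum_eq_zero
    intro j hj
    simp only [Finset.mem_range] at hj
    rw [hodd, mul_zero]
    obtain ⟨c, hc⟩ := ho
    exact ⟨c - j, by omega⟩

/-- The pairing of the Gegenbauer polynomial of degree `m` with the `m`-th power. -/
theorem gegenbauer_pairing_self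
    (heven : ∀ i n K, i + n = 2 * K → ((2 * K).choose i : ℝ) * A i n = sphereMoment ν K *
      ((Polynomial.X ^ 2 + Polynomial.C (2 * t) * Polynomial.X + 1 : Polynomial ℝ) ^ K).coeff i)
    (hν : -1 < ν) (m : ℕ) :
    gegenbauerCoeff ν m 0 *
      ∑ j ∈ Finset.range (m / 2 + 1), gegenbauerCoeff ν m j * A (m - 2 * j) m =
      normGegenbauer ν m t := by
  rcases Nat.eq_zero_or_pos m with rfl | hm
  · have := heven 0 0 0 rfl
    simp [sphereMoment, rising_zero] at this
    simp [gegenbauerCoeff, normGegenbauer_zero, this]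
  · rw [gegenbauer_pairing_inner heven hν (by omega) (show m + 2 * 0 = m by omega),
      normGegenbauer_eq_sum, Finset.mul_sum]
    apply Finset.sum_congr rfl
    intro u hu
    simp only [Finset.mem_range] at hu
    simp only [add_zero, Nat.sub_zero]
    rw [alternating_sum_rising_inv hν (by omega), gegenbauerCoeff, gegenbauerCoeff,
      if_neg (by omega), if_neg (by omega)]
    have h1 := rising_succ ν (m - 1)
    rw [show m - 1 + 1 = m by omega, Nat.cast_sub hm] at h1
    have h2 := (rising_pos hν (m - 1)).ne'
    have h3 : ν + m ≠ 0 := by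
      have : (1 : ℝ) ≤ m := by exact_mod_cast hm
      apply ne_of_gt
      linarith
    have h4 : rising ν m = rising ν (m - 1) * (m + ν) := by rw [h1]; push_cast; ring
    have h5 : (m : ℝ) + ν ≠ 0 := by rwa [add_comm]
    rw [h4, mul_pow]
    simp only [Nat.sub_zero, mul_zero, Nat.factorial_zero, Nat.cast_one, one_mul, pow_zero]
    field_simp

end

/-! ### Polar coordinates and Gaussian moments. -/

section

/-- Coefficients of everywhere convergent real power series are determined by the sum. -/
theorem coeff_unique_of_hasSum {c d : ℕ → ℝ} {f : ℝ → ℝ}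
    (hc : ∀ s, HasSum (fun k => s ^ k * c k) (f s)) (hd : ∀ s, HasSum (fun k => s ^ k * d k) (f s)) :
    c = d := by
  have h : ∀ {c : ℕ → ℝ}, (∀ s, HasSum (fun k => s ^ k * c k) (f s)) →
      HasFPowerSeriesAt f (FormalMultilinearSeries.ofScalars ℝ c) 0 := by
    intro c hc
    rw [hasFPowerSeriesAt_iff]
    refine Filter.Eventually.of_forall fun z => ?_
    simpa [FormalMultilinearSeries.coeff_ofScalars] using hc z
  have h1 := (h hc).eq_formalMultilinearSeries (h hd)
  funext k
  have := congrArg (fun p => p.coeff k) h1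
  simpa [FormalMultilinearSeries.coeff_ofScalars] using this

variable {E : Type*} [NormedAddCommGroup E] [InnerProductSpace ℝ E] [FiniteDimensional ℝ E]
  [MeasurableSpace E] [BorelSpace E]

/-- Integration in polar coordinates of a function that separates into a radial and a
spherical factor. -/
theorem integral_polar_mul [Nontrivial E] {𝕜 : Type*} [RCLike 𝕜] (h : E → 𝕜) (f : ℝ → 𝕜)
    (g : Metric.sphere (0 : E) 1 → 𝕜)
    (hfg : ∀ (η : Metric.sphere (0 : E) 1) (ρ : ℝ), 0 < ρ → h (ρ • (η : E)) = f ρ * g η) :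
    ∫ ξ, h ξ = (∫ η, g η ∂(volume : Measure E).toSphere) *
      ∫ ρ in Set.Ioi (0 : ℝ), (ρ : ℝ) ^ (Module.finrank ℝ E - 1) • f ρ :=
  calc
    ∫ ξ, h ξ = ∫ ξ : ({(0)}ᶜ : Set E), h (ξ : E) ∂((volume : Measure E).comap Subtype.val) := by
      rw [integral_subtype_comap (measurableSet_singleton _).compl h, restrict_compl_singleton]
    _ = ∫ p, g p.1 * f p.2 ∂(volume : Measure E).toSphere.prod
          (.volumeIoiPow (Module.finrank ℝ E - 1)) := by
      rw [← (volume : Measure E).measurePreserving_homeomorphUnitSphereProd.integral_comp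
        (Homeomorph.measurableEmbedding _) (fun p => g p.1 * f p.2)]
      refine integral_congr_ae (Filter.Eventually.of_forall fun ξ => ?_)
      have h0 : 0 < ‖(ξ : E)‖ := norm_pos_iff.2 ξ.2
      have h2 := hfg (homeomorphUnitSphereProd E ξ).1 ‖(ξ : E)‖ h0
      have h3 : ‖(ξ : E)‖ • ((homeomorphUnitSphereProd E ξ).1 : E) = ξ := by
        simp [smul_smul, h0.ne']
      rw [h3] at h2
      simp only [homeomorphUnitSphereProd_apply_snd_coe]
      rw [h2, mul_comm]
    _ = (∫ η, g η ∂(volume : Measure E).toSphere) *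
          ∫ ρ : Set.Ioi (0 : ℝ), f ρ ∂.volumeIoiPow (Module.finrank ℝ E - 1) :=
      integral_prod_mul g (fun ρ : Set.Ioi (0 : ℝ) => f ρ)
    _ = _ := by
      congr 1
      simp only [Measure.volumeIoiPow, ENNReal.ofReal]
      rw [integral_withDensity_eq_integral_smul,
        integral_subtype_comap measurableSet_Ioi
          fun a ↦ Real.toNNReal (a ^ (Module.finrank ℝ E - 1)) • f a,
        setIntegral_congr_fun measurableSet_Ioi fun x hx ↦ ?_]
      · rw [NNReal.smul_def, Real.coe_toNNReal _ (pow_nonneg (le_of_lt hx) _)]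
      · exact (measurable_subtype_coe.pow_const _).real_toNNReal

theorem integral_exp_neg_sq_add_inner (s : ℝ) (z : E) :
    ∫ ξ : E, Real.exp (-‖ξ‖ ^ 2 + s * inner ℝ z ξ) =
      (∫ ξ : E, Real.exp (-‖ξ‖ ^ 2)) * Real.exp (s ^ 2 * ‖z‖ ^ 2 / 4) := by
  have h1 := GaussianFourier.integral_cexp_neg_mul_sq_norm_add (b := 1) (V := E) (by simp) s z
  have h2 := GaussianFourier.integral_cexp_neg_mul_sq_norm_add (b := 1) (V := E) (by simp) 0 z
  simp only [neg_mul, one_mul, zero_mul, add_zero, mul_one, ne_eq, OfNat.ofNat_ne_zero,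
    not_false_eq_true, zero_pow, zero_div, Complex.exp_zero] at h1 h2
  rw [← h2] at h1
  have h3 : ((∫ ξ : E, Real.exp (-‖ξ‖ ^ 2 + s * inner ℝ z ξ) : ℝ) : ℂ) =
      ((∫ ξ : E, Real.exp (-‖ξ‖ ^ 2)) * Real.exp (s ^ 2 * ‖z‖ ^ 2 / 4) : ℝ) := by
    push_cast
    rw [← integral_complex_ofReal, ← integral_complex_ofReal]
    push_cast
    exact h1
  exact_mod_cast h3

theorem integrable_exp_neg_sq_add_inner (s : ℝ) (z : E) :
    Integrable fun ξ : E => Real.exp (-‖ξ‖ ^ 2 + s * inner ℝ z ξ) := by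
  have h1 := (GaussianFourier.integrable_cexp_neg_mul_sq_norm_add (b := 1) (V := E) (by simp)
    (s : ℂ) z).re
  refine h1.congr (Filter.Eventually.of_forall fun ξ => ?_)
  simp only [neg_mul, one_mul]
  rw [RCLike.re_eq_complex_re]
  have : (-(‖ξ‖ : ℂ) ^ 2 + s * (inner ℝ z ξ : ℝ)) = ((-‖ξ‖ ^ 2 + s * inner ℝ z ξ : ℝ) : ℂ) := by
    push_cast; ring
  rw [this, Complex.exp_ofReal_re]

/-- The exponential is expanded in powers of `s` and integrated termwise; `exp |x| ≤ exp x + exp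
(-x)` supplies an integrable majorant. -/
theorem hasSum_gaussian_moments (z : E) (s : ℝ) :
    HasSum (fun k : ℕ => s ^ k * ((∫ ξ : E, inner ℝ z ξ ^ k * Real.exp (-‖ξ‖ ^ 2)) / k.factorial))
      (∫ ξ : E, Real.exp (-‖ξ‖ ^ 2 + s * inner ℝ z ξ)) := by
  have key : ∀ (x : ℝ) (ξ : E), HasSum (fun k : ℕ => x ^ k / k.factorial * Real.exp (-‖ξ‖ ^ 2))
      (Real.exp (-‖ξ‖ ^ 2 + x)) := by
    intro x ξ
    rw [Real.exp_add, mul_comm (Real.exp _)]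
    refine HasSum.mul_right _ ?_
    rw [Real.exp_eq_exp_ℝ]
    exact NormedSpace.expSeries_div_hasSum_exp x
  have h := hasSum_integral_of_dominated_convergence (μ := (volume : Measure E))
    (F := fun (k : ℕ) ξ => (s * inner ℝ z ξ) ^ k / k.factorial * Real.exp (-‖ξ‖ ^ 2))
    (f := fun ξ => Real.exp (-‖ξ‖ ^ 2 + s * inner ℝ z ξ))
    (fun (k : ℕ) ξ => |s * inner ℝ z ξ| ^ k / k.factorial * Real.exp (-‖ξ‖ ^ 2))
    (fun k => (Continuous.aestronglyMeasurable (by fun_prop)))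
    (fun k => Filter.Eventually.of_forall fun ξ => by
      simp [abs_mul])
    (Filter.Eventually.of_forall fun ξ => (key _ ξ).summable)
    (by
      simp_rw [(key _ _).tsum_eq]
      refine ((integrable_exp_neg_sq_add_inner s z).add
        (integrable_exp_neg_sq_add_inner (-s) z)).mono'
        (Continuous.aestronglyMeasurable (by fun_prop)) (Filter.Eventually.of_forall fun ξ => ?_)
      simp only [Real.norm_eq_abs, Real.abs_exp, Pi.add_apply]
      rcases abs_cases (s * inner ℝ z ξ) with h | h
      · rw [h.1]
        linarith [Real.exp_pos (-‖ξ‖ ^ 2 + -s * inner ℝ z ξ)]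
      · rw [h.1, neg_mul]
        linarith [Real.exp_pos (-‖ξ‖ ^ 2 + s * inner ℝ z ξ)])
    (Filter.Eventually.of_forall fun ξ => key _ ξ)
  refine h.congr_fun ?_
  intro k
  rw [← integral_div, ← integral_const_mul]
  refine integral_congr_ae (Filter.Eventually.of_forall fun ξ => ?_)
  simp only
  rw [mul_pow]
  ring

/-- Two expansions of one Gaussian integral in powers of `s` are compared: by moments, and by
completing the square. Only even powers occur in the second. -/
theorem gaussian_moment_even (z : E) (K : ℕ) :
    ∫ ξ : E, inner ℝ z ξ ^ (2 * K) * Real.exp (-‖ξ‖ ^ 2) =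
      (∫ ξ : E, Real.exp (-‖ξ‖ ^ 2)) * ((2 * K).factorial / (4 ^ K * K.factorial) *
        ‖z‖ ^ (2 * K)) := by
  set G := ∫ ξ : E, Real.exp (-‖ξ‖ ^ 2) with hG
  let d : ℕ → ℝ := fun k => if Even k then G * (‖z‖ ^ 2 / 4) ^ (k / 2) / (k / 2).factorial else 0
  have hd : ∀ s : ℝ, HasSum (fun k => s ^ k * d k)
      (∫ ξ : E, Real.exp (-‖ξ‖ ^ 2 + s * inner ℝ z ξ)) := by
    intro s
    rw [integral_exp_neg_sq_add_inner]
    have h1 : HasSum (fun K : ℕ => s ^ (2 * K) * d (2 * K))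
        (G * Real.exp (s ^ 2 * ‖z‖ ^ 2 / 4)) := by
      have := (NormedSpace.expSeries_div_hasSum_exp (𝔸 := ℝ) (s ^ 2 * ‖z‖ ^ 2 / 4)).mul_left G
      rw [← Real.exp_eq_exp_ℝ] at this
      refine this.congr_fun fun K => ?_
      simp only [d, even_two, Even.mul_right, if_true, Nat.mul_div_cancel_left K two_pos]
      rw [mul_div_assoc (s ^ 2), mul_pow, pow_mul]
      ring
    have hinj : Function.Injective (fun K : ℕ => 2 * K) := fun a b h => by simpa using h
    refine (hinj.hasSum_iff ?_).1 h1
    intro k hk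
    have : ¬ Even k := by
      rintro ⟨c, hc⟩
      exact hk ⟨c, by simp only; omega⟩
    simp [d, this]
  have := congrFun (coeff_unique_of_hasSum (hasSum_gaussian_moments z) hd) (2 * K)
  simp only [d, even_two, Even.mul_right, if_true, Nat.mul_div_cancel_left K two_pos] at this
  have h0 : ((2 * K).factorial : ℝ) ≠ 0 := by positivity
  rw [div_eq_iff h0] at this
  rw [this, div_pow, pow_mul]
  field_simp

end

/-! ### Moments and reproducing kernels on the unit sphere. -/

section

theorem Gamma_add_nat_eq_rising {ν : ℝ} (hν : -1 < ν) (K : ℕ) :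
    Real.Gamma (ν + 1 + K) = rising ν K * Real.Gamma (ν + 1) := by
  induction K with
  | zero => simp [rising_zero]
  | succ K ih =>
    have h0 : (0 : ℝ) ≤ K := K.cast_nonneg
    rw [Nat.cast_succ, ← add_assoc, Real.Gamma_add_one (by linarith), ih, rising_succ]
    ring

/-- The index `dim E / 2 - 1` of the Gegenbauer polynomials on the unit sphere of `E`. -/
def sphereIndex (E : Type*) [NormedAddCommGroup E] [InnerProductSpace ℝ E] : ℝ :=
  (Module.finrank ℝ E : ℝ) / 2 - 1

section Dimension

variable {E : Type*} [NormedAddCommGroup E] [InnerProductSpace ℝ E] [FiniteDimensional ℝ E]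
  [Nontrivial E]

theorem neg_one_lt_sphereIndex : -1 < sphereIndex E := by
  have : (0 : ℝ) < Module.finrank ℝ E := by exact_mod_cast Module.finrank_pos
  simp only [sphereIndex]
  linarith

theorem integral_radial_gaussian (k : ℕ) :
    ∫ ρ in Set.Ioi (0 : ℝ), (ρ : ℝ) ^ (Module.finrank ℝ E - 1) •
      (ρ ^ k * Real.exp (-ρ ^ 2)) = Real.Gamma (sphereIndex E + 1 + k / 2) / 2 := by
  have hpos : 0 < Module.finrank ℝ E := Module.finrank_pos
  have hpos' : (0 : ℝ) < Module.finrank ℝ E := by exact_mod_cast hpos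
  have hk : (0 : ℝ) ≤ k := k.cast_nonneg
  have h := integral_rpow_mul_exp_neg_mul_rpow (p := 2) (q := (Module.finrank ℝ E : ℝ) - 1 + k)
    (b := 1) two_pos (by linarith) one_pos
  rw [Real.one_rpow] at h
  have e : ((Module.finrank ℝ E : ℝ) - 1 + k + 1) / 2 = sphereIndex E + 1 + k / 2 := by
    simp only [sphereIndex]; ring
  rw [e] at h
  trans 1 * (1 / 2) * Real.Gamma (sphereIndex E + 1 + k / 2)
  · rw [← h]
    refine setIntegral_congr_fun measurableSet_Ioi fun ρ hρ => ?_
    have hρ' : (0 : ℝ) < ρ := hρ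
    simp only [smul_eq_mul]
    rw [Real.rpow_add hρ', ← Nat.cast_pred hpos, Real.rpow_natCast, Real.rpow_natCast,
      Real.rpow_two, neg_one_mul, mul_assoc]
  · ring

end Dimension

variable {E : Type*} [NormedAddCommGroup E] [InnerProductSpace ℝ E] [FiniteDimensional ℝ E]
  [MeasurableSpace E] [BorelSpace E]

/-- The mean of a function over the unit sphere. -/
def sphereMean (g : Metric.sphere (0 : E) 1 → ℝ) : ℝ :=
  ((volume : Measure E).toSphere.real Set.univ)⁻¹ * ∫ η, g η ∂(volume : Measure E).toSphere

theorem integrable_sphere_of_continuous {g : Metric.sphere (0 : E) 1 → ℝ} (hg : Continuous g) :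
    Integrable g (volume : Measure E).toSphere :=
  hg.integrable_of_hasCompactSupport (HasCompactSupport.of_compactSpace g)

theorem sphereMean_sum {ι : Type*} (s : Finset ι) (g : ι → Metric.sphere (0 : E) 1 → ℝ)
    (hg : ∀ i, Continuous (g i)) :
    sphereMean (fun η => ∑ i ∈ s, g i η) = ∑ i ∈ s, sphereMean (g i) := by
  simp only [sphereMean]
  rw [integral_finsetSum _ fun i _ => integrable_sphere_of_continuous (hg i), Finset.mul_sum]

theorem sphereMean_const_mul (c : ℝ) (g : Metric.sphere (0 : E) 1 → ℝ) :
    sphereMean (fun η => c * g η) = c * sphereMean g := by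
  simp only [sphereMean]
  rw [integral_const_mul]
  ring

theorem continuous_normGegenbauer (ν : ℝ) (m : ℕ) : Continuous (normGegenbauer ν m) := by
  have : normGegenbauer ν m = fun t => ∑ j ∈ Finset.range (m / 2 + 1),
      gegenbauerCoeff ν m j * t ^ (m - 2 * j) := funext fun t => normGegenbauer_eq_sum ν t m
  rw [this]
  fun_prop

theorem sphereMean_gegenbauer_mul_expand (ω u : E) (m n : ℕ) :
    sphereMean (fun η : Metric.sphere (0 : E) 1 =>
      normGegenbauer (sphereIndex E) m (inner ℝ ω (η : E)) *
        normGegenbauer (sphereIndex E) n (inner ℝ u (η : E))) =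
      ∑ j ∈ Finset.range (n / 2 + 1), gegenbauerCoeff (sphereIndex E) n j *
        sphereMean (fun η : Metric.sphere (0 : E) 1 =>
          normGegenbauer (sphereIndex E) m (inner ℝ ω (η : E)) *
            inner ℝ u (η : E) ^ (n - 2 * j)) := by
  have hc := continuous_normGegenbauer (sphereIndex E) m
  simp only [normGegenbauer_eq_sum _ _ n, Finset.mul_sum]
  rw [sphereMean_sum _ _ fun j => by fun_prop]
  refine Finset.sum_congr rfl fun j _ => ?_
  rw [← sphereMean_const_mul]
  congr 1
  funext η
  ring

variable [Nontrivial E]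

theorem toSphere_real_univ_pos : 0 < (volume : Measure E).toSphere.real Set.univ := by
  rw [Measure.toSphere_real_apply_univ]
  have h1 : (0 : ℝ) < Module.finrank ℝ E := by exact_mod_cast Module.finrank_pos
  have h2 : 0 < (volume : Measure E).real (Metric.ball 0 1) :=
    ENNReal.toReal_pos (Metric.measure_ball_pos _ _ one_pos).ne' measure_ball_lt_top.ne
  positivity

theorem integral_inner_pow_mul_gaussian (z : E) (k : ℕ) :
    ∫ ξ : E, inner ℝ z ξ ^ k * Real.exp (-‖ξ‖ ^ 2) =
      (∫ η : Metric.sphere (0 : E) 1, inner ℝ z (η : E) ^ k ∂(volume : Measure E).toSphere) *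
        (Real.Gamma (sphereIndex E + 1 + k / 2) / 2) := by
  rw [← integral_radial_gaussian, integral_polar_mul _ (fun ρ => ρ ^ k * Real.exp (-ρ ^ 2))
    (fun η : Metric.sphere (0 : E) 1 => inner ℝ z (η : E) ^ k)]
  intro η ρ hρ
  have hη : ‖(η : E)‖ = 1 := by simp
  rw [inner_smul_right, norm_smul, hη, mul_one, Real.norm_eq_abs, sq_abs, mul_pow]
  ring

/-- The radial factor of the Gaussian moment is a Gamma value. Dividing by the zeroth moment removes
the surface area and leaves a rising factorial. -/
theorem sphereMean_inner_pow_even (z : E) (K : ℕ) :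
    sphereMean (fun η : Metric.sphere (0 : E) 1 => inner ℝ z (η : E) ^ (2 * K)) =
      sphereMoment (sphereIndex E) K * ‖z‖ ^ (2 * K) := by
  have hν := neg_one_lt_sphereIndex (E := E)
  have h1 := integral_inner_pow_mul_gaussian z (2 * K)
  have h0 := integral_inner_pow_mul_gaussian z 0
  simp only [pow_zero, one_mul, integral_const, smul_eq_mul, mul_one, Nat.cast_zero, zero_div,
    add_zero] at h0
  rw [gaussian_moment_even, h0] at h1
  have e : ((2 * K : ℕ) : ℝ) / 2 = K := by push_cast; ring
  rw [e, Gamma_add_nat_eq_rising hν] at h1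
  have h3 : 0 < Real.Gamma (sphereIndex E + 1) := Real.Gamma_pos_of_pos (by linarith)
  have h4 := toSphere_real_univ_pos (E := E)
  have h5 := rising_pos hν K
  rw [sphereMean, sphereMoment]
  set I := ∫ η : Metric.sphere (0 : E) 1, inner ℝ z (η : E) ^ (2 * K) ∂(volume : Measure E).toSphere
  field_simp at h1 ⊢
  linear_combination -h1

/-- The antipodal symmetry is used on the whole space, where Lebesgue measure is invariant under
negation: the Gaussian integral vanishes, and its radial factor is a positive Gamma value. -/
theorem sphereMean_inner_pow_mul_odd (ω u : E) {i n : ℕ} (h : Odd (i + n)) :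
    sphereMean (fun η : Metric.sphere (0 : E) 1 => inner ℝ ω (η : E) ^ i * inner ℝ u (η : E) ^ n) =
      0 := by
  have h1 := integral_polar_mul
    (fun ξ : E => inner ℝ ω ξ ^ i * inner ℝ u ξ ^ n * Real.exp (-‖ξ‖ ^ 2))
    (fun ρ => ρ ^ (i + n) * Real.exp (-ρ ^ 2))
    (fun η : Metric.sphere (0 : E) 1 => inner ℝ ω (η : E) ^ i * inner ℝ u (η : E) ^ n)
    (fun η ρ _ => by
      have hη : ‖(η : E)‖ = 1 := by simp
      rw [inner_smul_right, inner_smul_right, norm_smul, hη, mul_one, Real.norm_eq_abs, sq_abs,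
        mul_pow, mul_pow, pow_add]
      ring)
  have h2 : ∫ ξ : E, inner ℝ ω ξ ^ i * inner ℝ u ξ ^ n * Real.exp (-‖ξ‖ ^ 2) = 0 := by
    have := integral_neg_eq_self
      (fun ξ : E => inner ℝ ω ξ ^ i * inner ℝ u ξ ^ n * Real.exp (-‖ξ‖ ^ 2)) volume
    have e : ∀ ξ : E, (-inner ℝ ω ξ) ^ i * (-inner ℝ u ξ) ^ n * Real.exp (-‖ξ‖ ^ 2) =
        -(inner ℝ ω ξ ^ i * inner ℝ u ξ ^ n * Real.exp (-‖ξ‖ ^ 2)) := by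
      intro ξ
      rw [neg_pow (inner ℝ ω ξ), neg_pow (inner ℝ u ξ)]
      have := h.neg_one_pow (α := ℝ)
      rw [pow_add] at this
      linear_combination (inner ℝ ω ξ ^ i * inner ℝ u ξ ^ n * Real.exp (-‖ξ‖ ^ 2)) * this
    simp only [inner_neg_right, norm_neg, e, integral_neg] at this
    linarith
  have h3 : 0 < Real.Gamma (sphereIndex E + 1 + (i + n : ℕ) / 2) := by
    apply Real.Gamma_pos_of_pos
    have := neg_one_lt_sphereIndex (E := E)
    have hk : (0 : ℝ) ≤ (i + n : ℕ) := Nat.cast_nonneg _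
    linarith
  rw [h2, integral_radial_gaussian] at h1
  have h4 := (mul_eq_zero.1 h1.symm).resolve_right (by positivity)
  rw [sphereMean, h4, mul_zero]

/-- Polarization: the mixed moments are the coefficients of a power of a trinomial. -/
theorem sphereMean_inner_pow_mul_even {ω u : E} (hω : ‖ω‖ = 1) (hu : ‖u‖ = 1) {i n K : ℕ}
    (h : i + n = 2 * K) :
    ((2 * K).choose i : ℝ) *
      sphereMean (fun η : Metric.sphere (0 : E) 1 => inner ℝ ω (η : E) ^ i * inner ℝ u (η : E) ^ n) =
      sphereMoment (sphereIndex E) K *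
      ((Polynomial.X ^ 2 + Polynomial.C (2 * inner ℝ ω u) * Polynomial.X + 1 :
        Polynomial ℝ) ^ K).coeff i := by
  have hp : ∑ j ∈ Finset.range (2 * K + 1), Polynomial.C (((2 * K).choose j : ℝ) *
      sphereMean (fun η : Metric.sphere (0 : E) 1 =>
        inner ℝ ω (η : E) ^ j * inner ℝ u (η : E) ^ (2 * K - j))) * Polynomial.X ^ j =
      Polynomial.C (sphereMoment (sphereIndex E) K) *
      (Polynomial.X ^ 2 + Polynomial.C (2 * inner ℝ ω u) * Polynomial.X + 1 :
        Polynomial ℝ) ^ K := by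
    -- At each real `r` both sides are the mean of `⟨r ω + u, η⟩ ^ (2 K)`, since `‖r ω + u‖ ^ 2 = r
    -- ^ 2 + 2 ⟨ω, u⟩ r + 1`.
    apply Polynomial.funext
    intro r
    have h1 := sphereMean_inner_pow_even (r • ω + u) K
    have h2 : ‖r • ω + u‖ ^ (2 * K) = (r ^ 2 + 2 * inner ℝ ω u * r + 1) ^ K := by
      rw [pow_mul, norm_add_sq_real, norm_smul, hω, hu, inner_smul_left]
      simp
      ring
    rw [h2] at h1
    simp only [Polynomial.eval_finsetSum, Polynomial.eval_mul, Polynomial.eval_C,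
      Polynomial.eval_pow, Polynomial.eval_X, Polynomial.eval_add, Polynomial.eval_one]
    rw [← h1]
    simp only [inner_add_left, inner_smul_left, add_pow]
    rw [sphereMean_sum _ _ fun j => by fun_prop]
    apply Finset.sum_congr rfl
    intro j _
    rw [mul_right_comm, ← sphereMean_const_mul]
    congr 1
    funext η
    simp only [conj_trivial]
    ring
  have := congrArg (fun p => p.coeff i) hp
  simp only [Polynomial.finsetSum_coeff, Polynomial.coeff_C_mul, Polynomial.coeff_X_pow] at this
  rw [← this, Finset.sum_eq_single i]
  · simp [show 2 * K - i = n by omega]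
  · intro j _ hj
    simp [hj.symm]
  · intro hi
    simp at hi
    omega

/-- The mean of a Gegenbauer polynomial against a power of lower degree vanishes. -/
theorem sphereMean_gegenbauer_mul_pow_lt {ω u : E} (hω : ‖ω‖ = 1) (hu : ‖u‖ = 1) {m n : ℕ}
    (hn : n < m) :
    sphereMean (fun η : Metric.sphere (0 : E) 1 =>
      normGegenbauer (sphereIndex E) m (inner ℝ ω (η : E)) * inner ℝ u (η : E) ^ n) = 0 := by
  rw [← gegenbauer_pairing_lt (fun i n h => sphereMean_inner_pow_mul_odd ω u h)
    (fun i n K h => sphereMean_inner_pow_mul_even hω hu h) neg_one_lt_sphereIndex hn]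
  simp only [normGegenbauer_eq_sum, Finset.sum_mul]
  rw [sphereMean_sum _ _ fun j => by fun_prop]
  refine Finset.sum_congr rfl fun j _ => ?_
  rw [← sphereMean_const_mul]
  simp only [mul_assoc]

theorem sphereMean_gegenbauer_mul_pow_self {ω u : E} (hω : ‖ω‖ = 1) (hu : ‖u‖ = 1) (m : ℕ) :
    gegenbauerCoeff (sphereIndex E) m 0 * sphereMean (fun η : Metric.sphere (0 : E) 1 =>
      normGegenbauer (sphereIndex E) m (inner ℝ ω (η : E)) * inner ℝ u (η : E) ^ m) =
      normGegenbauer (sphereIndex E) m (inner ℝ ω u) := by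
  rw [← gegenbauer_pairing_self
    (fun i n K h => sphereMean_inner_pow_mul_even hω hu h) neg_one_lt_sphereIndex m]
  congr 1
  simp only [normGegenbauer_eq_sum, Finset.sum_mul]
  rw [sphereMean_sum _ _ fun j => by fun_prop]
  refine Finset.sum_congr rfl fun j _ => ?_
  rw [← sphereMean_const_mul]
  simp only [mul_assoc]

/-- The normalized Gegenbauer polynomials are the reproducing kernels of the spaces of spherical
harmonics. -/
theorem sphereMean_gegenbauer_mul_gegenbauer {ω u : E} (hω : ‖ω‖ = 1) (hu : ‖u‖ = 1) (m n : ℕ) :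
    sphereMean (fun η : Metric.sphere (0 : E) 1 =>
      normGegenbauer (sphereIndex E) m (inner ℝ ω (η : E)) *
        normGegenbauer (sphereIndex E) n (inner ℝ u (η : E))) =
      if m = n then normGegenbauer (sphereIndex E) m (inner ℝ ω u) else 0 := by
  have hlt : ∀ {ω u : E}, ‖ω‖ = 1 → ‖u‖ = 1 → ∀ {m n : ℕ}, n < m →
      sphereMean (fun η : Metric.sphere (0 : E) 1 =>
        normGegenbauer (sphereIndex E) m (inner ℝ ω (η : E)) *
        normGegenbauer (sphereIndex E) n (inner ℝ u (η : E))) = 0 := by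
    intro ω u hω hu m n hn
    rw [sphereMean_gegenbauer_mul_expand]
    refine Finset.sum_eq_zero fun j _ => ?_
    rw [sphereMean_gegenbauer_mul_pow_lt hω hu (by omega), mul_zero]
  rcases lt_trichotomy n m with h | h | h
  · rw [hlt hω hu h, if_neg h.ne']
  · subst h
    -- For equal degrees only the leading power `j = 0` of the second polynomial pairs nontrivially.
    rw [sphereMean_gegenbauer_mul_expand, if_pos rfl, Finset.sum_eq_single 0]
    · exact sphereMean_gegenbauer_mul_pow_self hω hu n
    · intro j hj hj0
      simp only [Finset.mem_range] at hj
      rw [sphereMean_gegenbauer_mul_pow_lt hω hu (by omega), mul_zero]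
    · simp
  · rw [if_neg h.ne]
    simp only [mul_comm (normGegenbauer (sphereIndex E) m _)]
    exact hlt hu hω h

/-- This is Cauchy-Schwarz for a reproducing kernel: the mean of `(F ω ∓ F u) ^ 2` is nonnegative
and equals `2 Č_m(1) ∓ 2 Č_m(⟨ω, u⟩)`. -/
theorem abs_normGegenbauer_le {ω u : E} (hω : ‖ω‖ = 1) (hu : ‖u‖ = 1) (m : ℕ) :
    |normGegenbauer (sphereIndex E) m (inner ℝ ω u)| ≤ normGegenbauer (sphereIndex E) m 1 := by
  have hc := continuous_normGegenbauer (sphereIndex E) m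
  set F : E → Metric.sphere (0 : E) 1 → ℝ := fun z η =>
    normGegenbauer (sphereIndex E) m (inner ℝ z (η : E)) with hF
  have hFc : ∀ z, Continuous (F z) := fun z => by simp only [hF]; fun_prop
  have h1 : ∀ {z w : E}, ‖z‖ = 1 → ‖w‖ = 1 → sphereMean (fun η => F z η * F w η) =
      normGegenbauer (sphereIndex E) m (inner ℝ z w) := fun hz hw => by
    rw [sphereMean_gegenbauer_mul_gegenbauer hz hw, if_pos rfl]
  have hself : ∀ z : E, ‖z‖ = 1 → inner ℝ z z = (1 : ℝ) := fun z hz => by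
    rw [real_inner_self_eq_norm_sq, hz, one_pow]
  have h2 := h1 hω hω
  have h3 := h1 hu hu
  rw [hself _ hω] at h2
  rw [hself _ hu] at h3
  have hS := toSphere_real_univ_pos (E := E)
  have key : ∀ s : ℝ, s ^ 2 = 1 →
      s * normGegenbauer (sphereIndex E) m (inner ℝ ω u) ≤ normGegenbauer (sphereIndex E) m 1 := by
    intro s hs
    have h4 : 0 ≤ sphereMean (fun η => (F ω η - s * F u η) ^ 2) :=
      mul_nonneg (inv_nonneg.2 hS.le) (integral_nonneg fun η => sq_nonneg _)
    have h5 : sphereMean (fun η => (F ω η - s * F u η) ^ 2) =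
        sphereMean (fun η => F ω η * F ω η) + (-2 * s) * sphereMean (fun η => F ω η * F u η) +
          sphereMean (fun η => F u η * F u η) := by
      simp only [sphereMean]
      have hcω := hFc ω
      have hcu := hFc u
      have i1 : Integrable (fun η => F ω η * F ω η) (volume : Measure E).toSphere :=
        integrable_sphere_of_continuous (by fun_prop)
      have i2 : Integrable (fun η => -2 * s * (F ω η * F u η)) (volume : Measure E).toSphere :=
        integrable_sphere_of_continuous (by fun_prop)
      have i3 : Integrable (fun η => F u η * F u η) (volume : Measure E).toSphere :=
        integrable_sphere_of_continuous (by fun_prop)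
      have i12 : Integrable (fun η => F ω η * F ω η + -2 * s * (F ω η * F u η))
        (volume : Measure E).toSphere := i1.add i2
      have : ∀ η, (F ω η - s * F u η) ^ 2 = F ω η * F ω η + (-2 * s) * (F ω η * F u η) +
          F u η * F u η := fun η => by linear_combination (F u η ^ 2) * hs
      simp only [this]
      rw [integral_add i12 i3, integral_add i1 i2, integral_const_mul]
      ring
    rw [h5, h2, h3, h1 hω hu] at h4
    linarith
  refine abs_le'.2 ⟨?_, ?_⟩
  · simpa using key 1 (by norm_num)
  · simpa using key (-1) (by norm_num)

end

/-! ### Growth of the values at `1`. -/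

/-- At `t = 1` the quadratic is `(1 - X) ^ 2` and the exponent is `-N / 2`, possibly a half-integer.
So the identity is proved for the square, and the constant coefficient excludes the sign `-1`. -/
theorem gegenbauerSeries_one_mul (N : ℕ) :
    gegenbauerSeries ((N : ℝ) / 2 - 1) 1 * (1 - PowerSeries.X) ^ N = 1 := by
  have hs := hasSubst_quadratic 1
  set S := gegenbauerSeries ((N : ℝ) / 2 - 1) 1 with hS
  have hsum : (N : ℝ) + (-((N : ℝ) / 2 - 1 + 1) + -((N : ℝ) / 2 - 1 + 1)) = 0 := by ring
  have h1 : PowerSeries.binomialSeries ℝ (N : ℝ) *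
      (PowerSeries.binomialSeries ℝ (-((N : ℝ) / 2 - 1 + 1)) *
        PowerSeries.binomialSeries ℝ (-((N : ℝ) / 2 - 1 + 1))) = 1 := by
    rw [← PowerSeries.binomialSeries_add, ← PowerSeries.binomialSeries_add, hsum,
      PowerSeries.binomialSeries_zero]
  have h2 := congrArg (PowerSeries.subst
    (PowerSeries.X ^ 2 - PowerSeries.C (2 * 1) * PowerSeries.X : PowerSeries ℝ)) h1
  rw [PowerSeries.binomialSeries_nat, PowerSeries.subst_mul hs, PowerSeries.subst_mul hs,
    PowerSeries.subst_pow hs, PowerSeries.subst_add hs, PowerSeries.subst_X hs,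
    ← PowerSeries.coe_substAlgHom hs, map_one] at h2
  rw [PowerSeries.coe_substAlgHom hs] at h2
  change _ * (S * S) = 1 at h2
  have h3 : (1 + (PowerSeries.X ^ 2 - PowerSeries.C (2 * 1) * PowerSeries.X) : PowerSeries ℝ) =
      (1 - PowerSeries.X) ^ 2 := by
    have : (PowerSeries.C (2 * 1 : ℝ)) = 2 := by
      rw [mul_one]; exact map_ofNat PowerSeries.C 2
    rw [this]; ring
  rw [h3] at h2
  have h4 : (S * (1 - PowerSeries.X) ^ N) * (S * (1 - PowerSeries.X) ^ N) = 1 := by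
    calc _ = ((1 - PowerSeries.X) ^ 2) ^ N * (S * S) := by
          rw [← pow_mul, mul_comm 2 N, pow_mul]; ring
      _ = 1 := h2
  rcases mul_self_eq_one_iff.1 h4 with h | h
  · exact h
  · exfalso
    have h5 := congrArg PowerSeries.constantCoeff h
    have h6 : PowerSeries.constantCoeff S = 1 := by
      rw [← PowerSeries.coeff_zero_eq_constantCoeff_apply, hS, coeff_gegenbauerSeries]
      simp [rising_zero]
    rw [map_mul, h6] at h5
    norm_num at h5

/-- The generating function of the values `Č_m(1)`. -/
theorem normGegenbauer_one_series (n : ℕ) :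
    PowerSeries.mk (fun m => normGegenbauer (((n + 1 : ℕ) : ℝ) / 2 - 1) m 1) *
      (1 - PowerSeries.X) ^ n = 1 + PowerSeries.X := by
  have h1 : PowerSeries.mk (fun m => normGegenbauer (((n + 1 : ℕ) : ℝ) / 2 - 1) m 1) =
      (1 - PowerSeries.X ^ 2) * gegenbauerSeries (((n + 1 : ℕ) : ℝ) / 2 - 1) 1 := by
    ext m
    rw [PowerSeries.coeff_mk]
    rfl
  have h2 := gegenbauerSeries_one_mul (n + 1)
  rw [h1]
  calc _ = (1 + PowerSeries.X) * (gegenbauerSeries (((n + 1 : ℕ) : ℝ) / 2 - 1) 1 *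
      (1 - PowerSeries.X) ^ (n + 1)) := by ring
    _ = _ := by rw [h2, mul_one]

theorem choose_add_le_pow (k m : ℕ) : (m + k).choose k ≤ (m + 1) ^ k := by
  induction k with
  | zero => simp
  | succ k ih =>
    have h := Nat.add_one_mul_choose_eq (m + k) k
    have h2 : (m + (k + 1)).choose (k + 1) * (k + 1) ≤ (m + 1) ^ (k + 1) * (k + 1) := by
      rw [← add_assoc, ← h, pow_succ]
      calc (m + k + 1) * (m + k).choose k ≤ ((m + 1) * (k + 1)) * (m + 1) ^ k :=
            Nat.mul_le_mul (by nlinarith) ih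
        _ = _ := by ring
    exact Nat.le_of_mul_le_mul_right h2 (Nat.succ_pos k)

/-- The values are the coefficients of `(1 + X) / (1 - X) ^ (N - 1)`. For `N ≥ 2` each is a sum of
at most two binomial coefficients, each at most `(m + 1) ^ (N - 2)`. The extra factor `m + 1` on the
left avoids the exponent `N - 2`, which is negative for `N = 1`. -/
theorem normGegenbauer_at_one_mul_le {N : ℕ} (hN : 1 ≤ N) (m : ℕ) :
    normGegenbauer ((N : ℝ) / 2 - 1) m 1 * (m + 1) ≤ 2 * ((m : ℝ) + 1) ^ (N - 1) := by
  obtain ⟨n, rfl⟩ : ∃ n, N = n + 1 := ⟨N - 1, by omega⟩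
  have h := normGegenbauer_one_series n
  rw [Nat.add_sub_cancel]
  rcases n with _ | d
  · rw [pow_zero, mul_one] at h
    have h1 := congrArg (PowerSeries.coeff m) h
    rw [PowerSeries.coeff_mk] at h1
    rw [h1]
    rcases m with _ | _ | m
    · simp
    · simp [PowerSeries.coeff_one]; norm_num
    · simp [PowerSeries.coeff_one, PowerSeries.coeff_X]
  · have h2 := PowerSeries.mk_add_choose_mul_one_sub_pow_eq_one ℝ d
    have h3 : PowerSeries.mk (fun m => normGegenbauer (((d + 1 + 1 : ℕ) : ℝ) / 2 - 1) m 1) =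
        PowerSeries.mk (fun n => ((d + n).choose d : ℝ)) * (1 + PowerSeries.X) := by
      calc _ = PowerSeries.mk (fun m => normGegenbauer (((d + 1 + 1 : ℕ) : ℝ) / 2 - 1) m 1) *
            (PowerSeries.mk (fun n => ((d + n).choose d : ℝ)) * (1 - PowerSeries.X) ^ (d + 1)) := by
            rw [h2, mul_one]
        _ = _ := by rw [← h]; ring
    have h4 := congrArg (PowerSeries.coeff m) h3
    rw [PowerSeries.coeff_mk, mul_add, mul_one, map_add, PowerSeries.coeff_mk] at h4
    have hle : ∀ k : ℕ, k ≤ m → ((d + k).choose d : ℝ) ≤ ((m : ℝ) + 1) ^ d := by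
      intro k hk
      have := choose_add_le_pow d k
      rw [add_comm d k]
      calc (((k + d).choose d : ℕ) : ℝ) ≤ (((k + 1) ^ d : ℕ) : ℝ) := by exact_mod_cast this
        _ ≤ _ := by
          push_cast
          have : (k : ℝ) ≤ m := by exact_mod_cast hk
          gcongr
    have h5 : PowerSeries.coeff m (PowerSeries.mk (fun n => ((d + n).choose d : ℝ)) *
        PowerSeries.X) ≤ ((m : ℝ) + 1) ^ d := by
      rcases m with _ | m
      · simp
      · rw [PowerSeries.coeff_succ_mul_X, PowerSeries.coeff_mk]
        exact hle m (by omega)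
    have h6 := hle m le_rfl
    rw [h4, pow_succ, ← mul_assoc]
    gcongr
    linarith

/-! ### Modified Bessel functions: growth in the argument and decay in the order. -/

/-- The terms of the series for `Ĩ_μ(2 v)` at real `v`. -/
def besselTerm (μ v : ℝ) (k : ℕ) : ℝ := v ^ (2 * k) / (k.factorial * Real.Gamma (μ + k + 1))

/-- The values `Ĩ_μ(2 v)` at real `v`. -/
def besselSum (μ v : ℝ) : ℝ := ∑' k, besselTerm μ v k

theorem Gamma_add_nat_add_one_pos {μ : ℝ} (hμ : -1 < μ) (k : ℕ) : 0 < Real.Gamma (μ + k + 1) := by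
  apply Real.Gamma_pos_of_pos
  have : (0 : ℝ) ≤ k := k.cast_nonneg
  linarith

theorem besselTerm_nonneg {μ v : ℝ} (hμ : -1 < μ) (k : ℕ) : 0 ≤ besselTerm μ v k := by
  have := Gamma_add_nat_add_one_pos hμ k
  have h2 : 0 ≤ v ^ (2 * k) := by rw [pow_mul]; positivity
  unfold besselTerm
  positivity

/-- Log-convexity of `Γ` between `j + δ + 1` and `j + δ + 2` bounds `Γ (j + 2)`, and the weighted
arithmetic-geometric mean inequality handles the resulting power. This trades a fractional order for
factorials. -/
theorem rpow_div_Gamma_le {v δ : ℝ} (hv : 0 < v) (h0 : 0 ≤ δ) (h1 : δ < 1) (j : ℕ) :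
    v ^ δ / Real.Gamma (j + δ + 1) ≤ v / (j + 1).factorial + 2 / j.factorial := by
  have hj : (0 : ℝ) ≤ j := j.cast_nonneg
  have hx : 0 < (j : ℝ) + δ + 1 := by linarith
  have hG := Real.Gamma_pos_of_pos hx
  have hconv : ((j + 1).factorial : ℝ) ≤
      Real.Gamma (j + δ + 1) * ((j : ℝ) + δ + 1) ^ (1 - δ) := by
    rcases eq_or_lt_of_le h0 with rfl | h0
    · rw [sub_zero, Real.rpow_one, add_zero, Real.Gamma_nat_eq_factorial, Nat.factorial_succ]
      push_cast
      linarith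
    have h := Real.Gamma_mul_add_mul_le_rpow_Gamma_mul_rpow_Gamma hx
      (show 0 < (j : ℝ) + δ + 1 + 1 by linarith) h0 (sub_pos.2 h1) (by ring)
    rw [show δ * ((j : ℝ) + δ + 1) + (1 - δ) * ((j : ℝ) + δ + 1 + 1) = ((j + 1 : ℕ) : ℝ) + 1 by
      push_cast; ring, Real.Gamma_nat_eq_factorial, Real.Gamma_add_one hx.ne',
      Real.mul_rpow hx.le hG.le, mul_left_comm, ← Real.rpow_add hG] at h
    simpa [mul_comm] using h
  have hamgm : v ^ δ * ((j : ℝ) + δ + 1) ^ (1 - δ) ≤ v + (j + 2) := by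
    have h := Real.geom_mean_le_arith_mean2_weighted h0 (sub_nonneg.2 h1.le) hv.le hx.le (by ring)
    refine h.trans ?_
    nlinarith
  have hf : (0 : ℝ) < (j + 1).factorial := by positivity
  calc v ^ δ / Real.Gamma (j + δ + 1)
      ≤ v ^ δ * ((j : ℝ) + δ + 1) ^ (1 - δ) / (j + 1).factorial := by
        rw [div_le_div_iff₀ hG hf]
        have := mul_le_mul_of_nonneg_left hconv (Real.rpow_nonneg hv.le δ)
        linarith
    _ ≤ (v + (j + 2)) / (j + 1).factorial := by gcongr
    _ ≤ _ := by
      rw [add_div]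
      refine add_le_add le_rfl ?_
      rw [div_le_div_iff₀ hf (by positivity), Nat.factorial_succ]
      push_cast
      have : (0 : ℝ) < j.factorial := by positivity
      nlinarith

/-- With `n = ⌊μ⌋`, the part of the term other than `v ^ k / k!` is controlled by single terms of
the exponential series, hence by `3 exp v`, uniformly in the order. -/
theorem rpow_mul_besselTerm_le {μ v : ℝ} (hμ : 0 ≤ μ) (hv : 0 < v) (k : ℕ) :
    v ^ μ * besselTerm μ v k ≤ 3 * Real.exp v * (v ^ k / k.factorial) := by
  set n := ⌊μ⌋₊
  have hn : (n : ℝ) ≤ μ := Nat.floor_le hμ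
  have hn' : μ < n + 1 := Nat.lt_floor_add_one μ
  have h := rpow_div_Gamma_le hv (sub_nonneg.2 hn) (show μ - n < 1 by linarith) (n + k)
  rw [show ((n + k : ℕ) : ℝ) + (μ - n) + 1 = μ + k + 1 by push_cast; ring] at h
  have hsplit : v ^ μ = v ^ n * v ^ (μ - n) := by
    rw [← Real.rpow_natCast, ← Real.rpow_add hv]
    congr 1; ring
  have e1 := Real.pow_div_factorial_le_exp v hv.le (n + k + 1)
  have e2 := Real.pow_div_factorial_le_exp v hv.le (n + k)
  calc v ^ μ * besselTerm μ v k
      = v ^ (n + 2 * k) / k.factorial * (v ^ (μ - n) / Real.Gamma (μ + k + 1)) := by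
        rw [besselTerm, hsplit, pow_add, div_mul_div_comm, ← mul_div_assoc]
        ring
    _ ≤ v ^ (n + 2 * k) / k.factorial *
        (v / (n + k + 1).factorial + 2 / (n + k).factorial) := by gcongr
    _ = v ^ k / k.factorial * (v ^ (n + k + 1) / (n + k + 1).factorial +
        2 * (v ^ (n + k) / (n + k).factorial)) := by
        ring
    _ ≤ v ^ k / k.factorial * (Real.exp v + 2 * Real.exp v) := by gcongr
    _ = _ := by ring

theorem hasSum_pow_div_factorial (v : ℝ) :
    HasSum (fun k : ℕ => v ^ k / k.factorial) (Real.exp v) := by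
  rw [Real.exp_eq_exp_ℝ]
  exact NormedSpace.expSeries_div_hasSum_exp v

theorem besselTerm_succ_index {μ v : ℝ} (hμ : -1 < μ) (k : ℕ) :
    besselTerm μ v k = (μ + 1 + k) * besselTerm (μ + 1) v k := by
  have hk : (0 : ℝ) ≤ k := k.cast_nonneg
  have h0 : μ + 1 + k ≠ 0 := by apply ne_of_gt; linarith
  have h1 := Gamma_add_nat_add_one_pos hμ k
  rw [besselTerm, besselTerm, Real.Gamma_add_one h0, show μ + k + 1 = μ + 1 + k by ring]
  rw [show μ + k + 1 = μ + 1 + k by ring] at h1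
  field_simp

theorem besselTerm_succ (μ v : ℝ) (k : ℕ) :
    (k + 1) * besselTerm μ v (k + 1) = v ^ 2 * besselTerm (μ + 1) v k := by
  rw [besselTerm, besselTerm, Nat.factorial_succ, mul_add, mul_one, pow_add]
  push_cast
  rw [show μ + 1 + k + 1 = μ + (k + 1) + 1 by ring]
  field_simp

theorem summable_besselTerm_of_nonneg {μ : ℝ} (hμ : 0 ≤ μ) (v : ℝ) :
    Summable (besselTerm μ v) := by
  have habs : besselTerm μ v = besselTerm μ |v| := by
    funext k
    rw [besselTerm, besselTerm, pow_mul, pow_mul, sq_abs]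
  rw [habs]
  rcases eq_or_lt_of_le (abs_nonneg v) with h | h
  · rw [← h]
    refine summable_of_ne_finset_zero (s := {0}) fun k hk => ?_
    have : k ≠ 0 := by simpa using hk
    simp [besselTerm, this]
  · have hpow : 0 < |v| ^ μ := Real.rpow_pos_of_pos h μ
    refine (summable_mul_left_iff hpow.ne').1 ?_
    refine Summable.of_nonneg_of_le (fun k => mul_nonneg hpow.le
      (besselTerm_nonneg (by linarith) k)) (fun k => rpow_mul_besselTerm_le hμ h k) ?_
    exact (hasSum_pow_div_factorial |v|).summable.mul_left _

/-- Each term of order `μ` is `(μ + 1) + k` times the term of order `μ + 1`; the part with `k`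
shifts to order `μ + 2`. For `-1 < μ < 0` both orders on the right are positive, which extends
summability to this range. -/
theorem hasSum_besselTerm_recurrence {μ : ℝ} (hμ : -1 < μ) (v : ℝ) :
    HasSum (besselTerm μ v) ((μ + 1) * besselSum (μ + 1) v + v ^ 2 * besselSum (μ + 2) v) := by
  have s1 : HasSum (besselTerm (μ + 1) v) (besselSum (μ + 1) v) :=
    (summable_besselTerm_of_nonneg (by linarith) v).hasSum
  have s2 : HasSum (besselTerm (μ + 1 + 1) v) (besselSum (μ + 2) v) := by
    rw [show μ + 2 = μ + 1 + 1 by ring]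
    exact (summable_besselTerm_of_nonneg (by linarith) v).hasSum
  have s3 : HasSum (fun k : ℕ => k * besselTerm (μ + 1) v k) (v ^ 2 * besselSum (μ + 2) v) := by
    rw [← hasSum_nat_add_iff' 1]
    simp only [Finset.range_one, Finset.sum_singleton, Nat.cast_zero, zero_mul, sub_zero]
    refine (s2.mul_left (v ^ 2)).congr_fun fun k => ?_
    rw [← besselTerm_succ]
    push_cast
    ring
  refine ((s1.mul_left (μ + 1)).add s3).congr_fun fun k => ?_
  rw [besselTerm_succ_index hμ]
  ring

theorem summable_besselTerm {μ : ℝ} (hμ : -1 < μ) (v : ℝ) : Summable (besselTerm μ v) :=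
  (hasSum_besselTerm_recurrence hμ v).summable

theorem besselSum_nonneg {μ : ℝ} (hμ : -1 < μ) (v : ℝ) : 0 ≤ besselSum μ v :=
  tsum_nonneg fun k => besselTerm_nonneg hμ k

theorem besselSum_mono {μ v w : ℝ} (hμ : -1 < μ) (hv : 0 ≤ v) (hw : v ≤ w) :
    besselSum μ v ≤ besselSum μ w := by
  refine (summable_besselTerm hμ v).tsum_le_tsum (fun k => ?_) (summable_besselTerm hμ w)
  have := Gamma_add_nat_add_one_pos hμ k
  unfold besselTerm
  gcongr

theorem rpow_mul_besselSum_le_of_nonneg {μ v : ℝ} (hμ : 0 ≤ μ) (hv : 0 < v) :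
    v ^ μ * besselSum μ v ≤ 3 * Real.exp (2 * v) := by
  rw [besselSum, ← tsum_mul_left, two_mul, Real.exp_add, ← mul_assoc]
  have h := (hasSum_pow_div_factorial v).mul_left (3 * Real.exp v)
  rw [← h.tsum_eq]
  exact ((summable_besselTerm_of_nonneg hμ v).mul_left _).tsum_le_tsum
    (fun k => rpow_mul_besselTerm_le hμ hv k) h.summable

/-- The modified Bessel functions `I_μ(2 v)` are bounded by a multiple of `exp (2 v)`, uniformly
in the order. -/
theorem rpow_mul_besselSum_le {μ v : ℝ} (hμ : -1 < μ) (hv : 1 ≤ v) :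
    v ^ μ * besselSum μ v ≤ 6 * Real.exp (2 * v) := by
  have hv0 : 0 < v := by linarith
  have he := Real.exp_pos (2 * v)
  rcases le_or_gt 0 μ with h | h
  · linarith [rpow_mul_besselSum_le_of_nonneg h hv0]
  -- For negative orders the recurrence is applied. Since `μ + 1 < 1 ≤ v`, each of its two terms
  -- costs at most `3 exp (2 v)`, whence the constant `6`.
  · have h1 := rpow_mul_besselSum_le_of_nonneg (show 0 ≤ μ + 1 by linarith) hv0
    have h2 := rpow_mul_besselSum_le_of_nonneg (show 0 ≤ μ + 2 by linarith) hv0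
    have h3 : v ^ μ * besselSum μ v = (μ + 1) * (v ^ μ * besselSum (μ + 1) v) +
        v ^ (μ + 2) * besselSum (μ + 2) v := by
      rw [besselSum, (hasSum_besselTerm_recurrence hμ v).tsum_eq, Real.rpow_add hv0 μ 2,
        Real.rpow_two]
      ring
    have h4 : v ^ μ * besselSum (μ + 1) v ≤ v ^ (μ + 1) * besselSum (μ + 1) v :=
      mul_le_mul_of_nonneg_right (Real.rpow_le_rpow_of_exponent_le hv (by linarith))
        (besselSum_nonneg (by linarith) v)
    have h5 : 0 ≤ v ^ (μ + 1) * besselSum (μ + 1) v :=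
      mul_nonneg (Real.rpow_nonneg hv0.le _) (besselSum_nonneg (by linarith) v)
    nlinarith

/-- Each raising of the order divides the `k`-th term by at least `μ + 1`. -/
theorem besselSum_add_nat_le {μ : ℝ} (hμ : -1 < μ) (v : ℝ) (p : ℕ) :
    besselSum (μ + p) v * (μ + 1) ^ p ≤ besselSum μ v := by
  induction p with
  | zero => simp
  | succ p ih =>
    have hp : (0 : ℝ) ≤ p := p.cast_nonneg
    refine le_trans ?_ ih
    rw [pow_succ', ← mul_assoc]
    have hμ1 : 0 ≤ μ + 1 := by linarith
    gcongr
    rw [besselSum, besselSum, ← tsum_mul_right]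
    refine ((summable_besselTerm (by push_cast; linarith) v).mul_right _).tsum_le_tsum
      (fun k => ?_) (summable_besselTerm (by linarith) v)
    have hk : (0 : ℝ) ≤ k := k.cast_nonneg
    rw [besselTerm_succ_index (μ := μ + p) (by linarith), mul_comm]
    push_cast
    rw [← add_assoc]
    exact mul_le_mul_of_nonneg_right (by linarith) (besselTerm_nonneg (by linarith) k)

/-- Decay of the modified Bessel functions in the order. -/
theorem rpow_mul_besselSum_mul_pow_le {μ v : ℝ} (hμ : -1 < μ) (hv : 1 ≤ v) (N : ℕ) :
    v ^ μ * besselSum μ v * (μ + 1) ^ N ≤ 6 * (2 * N + 1) ^ N * Real.exp (2 * v) * v ^ N := by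
  have hv0 : 0 < v := by linarith
  have hμ1 : 0 < μ + 1 := by linarith
  have hN : (0 : ℝ) ≤ N := N.cast_nonneg
  have he := Real.exp_pos (2 * v)
  -- For large orders, lowering by `N` keeps `μ - N + 1` comparable to `μ + 1`. For small orders `(μ
  -- + 1) ^ N` is bounded and `1 ≤ v ^ N` suffices.
  rcases le_or_gt (2 * (N : ℝ)) (μ + 1) with h | h
  · rcases Nat.eq_zero_or_pos N with rfl | hN1
    · simpa using rpow_mul_besselSum_le hμ hv
    have hN1' : (1 : ℝ) ≤ N := by exact_mod_cast hN1
    have h1 : -1 < μ - N := by linarith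
    have h2 := besselSum_add_nat_le h1 v N
    rw [sub_add_cancel] at h2
    have h3 := rpow_mul_besselSum_le h1 hv
    have h4 : v ^ μ = v ^ (μ - N) * v ^ N := by
      rw [← Real.rpow_natCast, ← Real.rpow_add hv0, sub_add_cancel]
    have h5 : (μ + 1) ^ N ≤ (2 * N + 1) ^ N * (μ - N + 1) ^ N := by
      rw [← mul_pow]
      gcongr
      nlinarith
    have hJ := besselSum_nonneg hμ v
    calc v ^ μ * besselSum μ v * (μ + 1) ^ N
        ≤ v ^ μ * besselSum μ v * ((2 * N + 1) ^ N * (μ - N + 1) ^ N) := by gcongr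
      _ = (2 * N + 1) ^ N * v ^ N * v ^ (μ - N) * (besselSum μ v * (μ - N + 1) ^ N) := by
        rw [h4]; ring
      _ ≤ (2 * N + 1) ^ N * v ^ N * v ^ (μ - N) * besselSum (μ - N) v := by gcongr
      _ = (2 * N + 1) ^ N * v ^ N * (v ^ (μ - N) * besselSum (μ - N) v) := by ring
      _ ≤ (2 * N + 1) ^ N * v ^ N * (6 * Real.exp (2 * v)) := by gcongr
      _ = _ := by ring
  · have h1 := rpow_mul_besselSum_le hμ hv
    have hv1 : 1 ≤ v ^ N := one_le_pow₀ hv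
    calc v ^ μ * besselSum μ v * (μ + 1) ^ N
        ≤ 6 * Real.exp (2 * v) * (2 * N + 1) ^ N := by
          gcongr
          linarith
      _ ≤ 6 * Real.exp (2 * v) * (2 * N + 1) ^ N * v ^ N :=
          le_mul_of_one_le_right (by positivity) hv1
      _ = _ := by ring

/-- Bound for the terms of the series `∑ v ^ (b m) Ĩ_{b m + l}(2 v) (m + 1) ^ (N - 2)`. -/
theorem exists_series_term_bound {N : ℕ} (hN : 1 ≤ N) {b l : ℝ} (hb : 0 < b) (hl : -1 < l) :
    ∃ C : ℝ, 0 < C ∧ ∀ (m : ℕ) (v : ℝ), 0 ≤ v →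
      v ^ (b * m) * besselSum (b * m + l) v * (2 * ((m : ℝ) + 1) ^ (N - 1) / (m + 1)) ≤
        C * Real.exp (2 * v) * (1 + v ^ ((N : ℝ) - l)) * (1 / ((m : ℝ) + 1) ^ 2) := by
  -- This choice gives `c (m + 1) ≤ b m + l + 1` for every `m`, including `m = 0`.
  set c := min b (l + 1) with hc
  have hc0 : 0 < c := lt_min hb (by linarith)
  set C₁ : ℝ := 12 * (2 * N + 1) ^ N / c ^ N with hC₁
  have hC₁pos : 0 < C₁ := by positivity
  have hμ : ∀ m : ℕ, -1 < b * m + l := fun m => by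
    have : 0 ≤ b * m := by positivity
    linarith
  have hcm : ∀ m : ℕ, c * (m + 1) ≤ b * m + l + 1 := fun m => by
    have hm : (0 : ℝ) ≤ m := m.cast_nonneg
    have h1 : c * m ≤ b * m := mul_le_mul_of_nonneg_right (min_le_left _ _) hm
    have h2 : c ≤ l + 1 := min_le_right _ _
    linarith
  -- Decay of order `N` in `m + 1` against growth of order `N - 2` leaves `(m + 1) ^ (-2)`.
  have hlarge : ∀ (m : ℕ) (v : ℝ), 1 ≤ v →
      v ^ (b * m) * besselSum (b * m + l) v * (2 * ((m : ℝ) + 1) ^ (N - 1) / (m + 1)) ≤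
        C₁ * Real.exp (2 * v) * v ^ ((N : ℝ) - l) * (1 / ((m : ℝ) + 1) ^ 2) := by
    intro m v hv
    have hv0 : 0 < v := by linarith
    have hm1 : (0 : ℝ) < m + 1 := by positivity
    have h1 := rpow_mul_besselSum_mul_pow_le (hμ m) hv N
    have hJ := besselSum_nonneg (hμ m) v
    have h2 : v ^ (b * m + l) * besselSum (b * m + l) v * (c * (m + 1)) ^ N ≤
        6 * (2 * N + 1) ^ N * Real.exp (2 * v) * v ^ N := by
      refine le_trans ?_ h1
      gcongr
      exact hcm m
    have e1 : v ^ (b * m) = v ^ (b * m + l) * v ^ (-l) := by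
      rw [← Real.rpow_add hv0]; congr 1; ring
    have e2 : v ^ ((N : ℝ) - l) = v ^ N * v ^ (-l) := by
      rw [← Real.rpow_natCast, ← Real.rpow_add hv0]; rfl
    have e3 : ((m : ℝ) + 1) ^ N = ((m : ℝ) + 1) ^ (N - 1) * (m + 1) := by
      rw [← pow_succ, Nat.sub_add_cancel hN]
    have hl0 : 0 < v ^ (-l) := Real.rpow_pos_of_pos hv0 _
    rw [e1, e2, hC₁]
    rw [mul_pow, e3] at h2
    have h3 := mul_le_mul_of_nonneg_right h2
      (show 0 ≤ 2 * v ^ (-l) / (c ^ N * (m + 1) ^ 2) by positivity)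
    have e4 : v ^ (b * m + l) * v ^ (-l) * besselSum (b * m + l) v *
        (2 * ((m : ℝ) + 1) ^ (N - 1) / (m + 1)) =
        v ^ (b * m + l) * besselSum (b * m + l) v *
          (c ^ N * (((m : ℝ) + 1) ^ (N - 1) * (m + 1))) *
          (2 * v ^ (-l) / (c ^ N * (m + 1) ^ 2)) := by
      field_simp
    rw [e4]
    refine h3.trans (le_of_eq ?_)
    field_simp
    ring
  refine ⟨C₁ * Real.exp 2, by positivity, fun m v hv => ?_⟩
  have he2 : 1 ≤ Real.exp 2 := Real.one_le_exp (by norm_num)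
  have hrp : 0 ≤ v ^ ((N : ℝ) - l) := Real.rpow_nonneg hv _
  rcases le_or_gt 1 v with h | h
  · refine (hlarge m v h).trans ?_
    gcongr
    · exact le_mul_of_one_le_right hC₁pos.le he2
    · linarith
  -- For `v < 1` the terms are compared with those at `1`. The power `v ^ (N - l)` enters only
  -- through its nonnegativity, so its default value at `v = 0` is harmless.
  · have h1 := hlarge m 1 le_rfl
    rw [Real.one_rpow, Real.one_rpow, one_mul, mul_one, mul_one] at h1
    have hJ := besselSum_nonneg (hμ m) v
    have hJ1 := besselSum_mono (hμ m) hv h.le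
    have hJ2 := besselSum_nonneg (hμ m) 1
    have hv1 : v ^ (b * m) ≤ 1 := Real.rpow_le_one hv h.le (by positivity)
    calc _ ≤ 1 * besselSum (b * m + l) 1 * (2 * ((m : ℝ) + 1) ^ (N - 1) / (m + 1)) := by gcongr
      _ ≤ C₁ * Real.exp 2 * (1 / ((m : ℝ) + 1) ^ 2) := by rw [one_mul]; exact h1
      _ ≤ C₁ * Real.exp 2 * Real.exp (2 * v) * (1 + v ^ ((N : ℝ) - l)) *
          (1 / ((m : ℝ) + 1) ^ 2) := by
        have h2 := Real.one_le_exp (show 0 ≤ 2 * v by linarith)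
        have h3 : 1 ≤ Real.exp (2 * v) * (1 + v ^ ((N : ℝ) - l)) := by nlinarith
        have h4 := le_mul_of_one_le_right
          (show 0 ≤ C₁ * Real.exp 2 * (1 / ((m : ℝ) + 1) ^ 2) by positivity) h3
        linarith

/-! ### Weber's second exponential integral in series form. -/

/-- A Chu-Vandermonde identity. -/
theorem sum_inv_factorial_mul_Gamma {μ : ℝ} (hμ : -1 < μ) (k l : ℕ) :
    ∑ j ∈ Finset.range (k + 1), (if j ≤ l then
      (((k - j).factorial : ℝ) * (l - j).factorial * (j.factorial * Real.Gamma (μ + j + 1)))⁻¹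
      else 0) =
    Real.Gamma (μ + k + l + 1) / (k.factorial * l.factorial * Real.Gamma (μ + k + 1) *
      Real.Gamma (μ + l + 1)) := by
  induction k generalizing l μ with
  | zero =>
    have h0 := (Gamma_add_nat_add_one_pos hμ l).ne'
    simp only [zero_add, Finset.range_one, Finset.sum_singleton, zero_le, if_true, Nat.sub_zero,
      Nat.factorial_zero, Nat.cast_one, one_mul, Nat.cast_zero, add_zero]
    field_simp
  | succ k ih =>
    rcases l with _ | l
    · rw [Finset.sum_eq_single 0]
      · have h0 := (Gamma_add_nat_add_one_pos hμ (k + 1)).ne'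
        push_cast at h0
        simp
        field_simp
      · intro j _ hj
        rw [if_neg (by omega)]
      · simp
    · have e1 := ih hμ (l + 1)
      have e2 := ih (show -1 < μ + 1 by linarith) l
      -- The factor `k + 1` is split as `(k + 1 - j) + j`. The first part lowers `k`; the second
      -- shifts `j`, lowers both `k` and `l` and raises `μ` by one.
      have hrec : ((k : ℝ) + 1) * ∑ j ∈ Finset.range (k + 1 + 1), (if j ≤ l + 1 then
          (((k + 1 - j).factorial : ℝ) * (l + 1 - j).factorial *
            (j.factorial * Real.Gamma (μ + j + 1)))⁻¹ else 0) =
          (∑ j ∈ Finset.range (k + 1), (if j ≤ l + 1 then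
          (((k - j).factorial : ℝ) * (l + 1 - j).factorial *
            (j.factorial * Real.Gamma (μ + j + 1)))⁻¹ else 0)) +
          ∑ j ∈ Finset.range (k + 1), (if j ≤ l then
          (((k - j).factorial : ℝ) * (l - j).factorial *
            (j.factorial * Real.Gamma (μ + 1 + j + 1)))⁻¹ else 0) := by
        have t1 : ∑ j ∈ Finset.range (k + 1), (if j ≤ l + 1 then
            (((k - j).factorial : ℝ) * (l + 1 - j).factorial *
            (j.factorial * Real.Gamma (μ + j + 1)))⁻¹ else 0) =
            ∑ j ∈ Finset.range (k + 1 + 1), ((k : ℝ) + 1 - j) * (if j ≤ l + 1 then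
            (((k + 1 - j).factorial : ℝ) * (l + 1 - j).factorial *
            (j.factorial * Real.Gamma (μ + j + 1)))⁻¹ else 0) := by
          rw [Finset.sum_range_succ _ (k + 1)]
          push_cast
          rw [sub_self, zero_mul, add_zero]
          refine Finset.sum_congr rfl fun j hj => ?_
          simp only [Finset.mem_range] at hj
          split_ifs
          · rw [show k + 1 - j = k - j + 1 by omega, Nat.factorial_succ]
            push_cast [show j ≤ k by omega]
            have : (k : ℝ) - j + 1 ≠ 0 := by
              have : (j : ℝ) ≤ k := by exact_mod_cast (show j ≤ k by omega)
              apply ne_of_gt; linarith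
            field_simp
            ring
          · simp
        have t2 : ∑ j ∈ Finset.range (k + 1), (if j ≤ l then
            (((k - j).factorial : ℝ) * (l - j).factorial *
            (j.factorial * Real.Gamma (μ + 1 + j + 1)))⁻¹ else 0) =
            ∑ j ∈ Finset.range (k + 1 + 1), (j : ℝ) * (if j ≤ l + 1 then
            (((k + 1 - j).factorial : ℝ) * (l + 1 - j).factorial *
            (j.factorial * Real.Gamma (μ + j + 1)))⁻¹ else 0) := by
          rw [Finset.sum_range_succ' _ (k + 1)]
          push_cast
          rw [zero_mul, add_zero]
          refine Finset.sum_congr rfl fun j _ => ?_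
          split_ifs
          · rw [Nat.factorial_succ, show μ + (j + 1) + 1 = μ + 1 + j + 1 by ring]
            push_cast
            field_simp
          · simp
        rw [t1, t2, ← Finset.sum_add_distrib, Finset.mul_sum]
        refine Finset.sum_congr rfl fun j _ => ?_
        ring
      have hk : (k : ℝ) + 1 ≠ 0 := by positivity
      rw [← mul_right_inj' hk, hrec, e1, e2]
      have hkn : (0 : ℝ) ≤ k := k.cast_nonneg
      have hln : (0 : ℝ) ≤ l := l.cast_nonneg
      have hx : μ + k + 1 ≠ 0 := by apply ne_of_gt; linarith
      have hz : μ + k + l + 2 ≠ 0 := by apply ne_of_gt; linarith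
      have g1 := (Gamma_add_nat_add_one_pos hμ k).ne'
      have g2 := (Gamma_add_nat_add_one_pos hμ (l + 1)).ne'
      push_cast at g2 ⊢
      rw [show μ + (k + 1) + 1 = (μ + k + 1) + 1 by ring, Real.Gamma_add_one hx,
        show μ + (k + 1) + (l + 1) + 1 = (μ + k + l + 2) + 1 by ring, Real.Gamma_add_one hz,
        show μ + k + (l + 1) + 1 = μ + k + l + 2 by ring,
        show μ + 1 + k + l + 1 = μ + k + l + 2 by ring,
        show μ + 1 + k + 1 = (μ + k + 1) + 1 by ring, Real.Gamma_add_one hx,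
        show μ + 1 + l + 1 = μ + (l + 1) + 1 by ring, Nat.factorial_succ, Nat.factorial_succ]
      push_cast
      field_simp
      ring

theorem hasSum_mul_of_summable_norm {ι κ R : Type*} [NormedRing R] [CompleteSpace R]
    {f : ι → R} {g : κ → R} {a b : R}
    (hf : HasSum f a) (hg : HasSum g b) (hf' : Summable fun i => ‖f i‖)
    (hg' : Summable fun i => ‖g i‖) : HasSum (fun p : ι × κ => f p.1 * g p.2) (a * b) :=
  hf.mul hg (summable_mul_of_summable_norm hf' hg')

/-- The series form of Weber's second exponential integral. -/
theorem hasSum_weber {μ A B v : ℝ} (hμ : -1 < μ) (hv : v ^ 2 = A * B) :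
    HasSum (fun p : ℕ × ℕ => (-A) ^ p.1 * (-B) ^ p.2 * (Real.Gamma (μ + p.1 + p.2 + 1) /
      (p.1.factorial * p.2.factorial * Real.Gamma (μ + p.1 + 1) * Real.Gamma (μ + p.2 + 1))))
      (Real.exp (-A) * Real.exp (-B) * besselSum μ v) := by
  have ha := hasSum_pow_div_factorial (-A)
  have hb := hasSum_pow_div_factorial (-B)
  have hc : HasSum (besselTerm μ v) (besselSum μ v) := (summable_besselTerm hμ v).hasSum
  have hab := hasSum_mul_of_summable_norm ha hb ha.summable.norm hb.summable.norm
  have habc := hasSum_mul_of_summable_norm hab hc hab.summable.norm hc.summable.norm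
  -- The triple product of series is regrouped by the total exponents of `-A` and `-B`; the fibre
  -- over `(k, l)` is then a finite Chu-Vandermonde sum.
  let e : (ℕ × ℕ) × ℕ → (ℕ × ℕ) × ℕ := fun p => ((p.1.1 + p.2, p.1.2 + p.2), p.2)
  have he : Function.Injective e := by
    rintro ⟨⟨i, i'⟩, j⟩ ⟨⟨i₂, i₂'⟩, j₂⟩ h
    simp only [e, Prod.mk.injEq] at h ⊢
    omega
  let F : (ℕ × ℕ) × ℕ → ℝ := fun p => if p.2 ≤ p.1.1 ∧ p.2 ≤ p.1.2 then
    (-A) ^ (p.1.1 - p.2) / (p.1.1 - p.2).factorial *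
      ((-B) ^ (p.1.2 - p.2) / (p.1.2 - p.2).factorial) * besselTerm μ v p.2 else 0
  have hF : HasSum F (Real.exp (-A) * Real.exp (-B) * besselSum μ v) := by
    refine (he.hasSum_iff ?_).1 (habc.congr_fun ?_)
    · rintro ⟨⟨k, l⟩, j⟩ hp
      simp only [F]
      rw [if_neg]
      rintro ⟨h1, h2⟩
      exact hp ⟨((k - j, l - j), j), by simp only [e, Prod.mk.injEq, and_true]; omega⟩
    · rintro ⟨⟨i, i'⟩, j⟩
      simp [F, e]
  refine HasSum.prod_fiberwise hF fun p => ?_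
  obtain ⟨k, l⟩ := p
  have hz : ∀ j ∉ Finset.range (k + 1), F ((k, l), j) = 0 := by
    intro j hj
    simp only [Finset.mem_range] at hj
    simp only [F]
    rw [if_neg (by omega)]
  have hfin : HasSum (fun j => F ((k, l), j)) (∑ j ∈ Finset.range (k + 1), F ((k, l), j)) :=
    hasSum_sum_of_ne_finset_zero hz
  convert hfin using 1
  rw [← sum_inv_factorial_mul_Gamma hμ, Finset.mul_sum]
  refine Finset.sum_congr rfl fun j hj => ?_
  simp only [Finset.mem_range] at hj
  simp only [F]
  by_cases hjl : j ≤ l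
  · rw [if_pos hjl, if_pos ⟨by omega, hjl⟩, besselTerm, pow_mul v, hv]
    have h1 : (-A) ^ k = (-A) ^ (k - j) * (-A) ^ j := by rw [← pow_add]; congr 1; omega
    have h2 : (-B) ^ l = (-B) ^ (l - j) * (-B) ^ j := by rw [← pow_add]; congr 1; omega
    have h3 : (A * B) ^ j = (-A) ^ j * (-B) ^ j := by rw [← mul_pow]; congr 1; ring
    rw [h1, h2, h3]
    field_simp
  · rw [if_neg hjl, if_neg (by omega), mul_zero]

/-! ### Absolutely convergent series for the Fourier kernel. -/

theorem summable_one_div_succ_sq : Summable fun m : ℕ => 1 / ((m : ℝ) + 1) ^ 2 := by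
  have h := (summable_nat_add_iff 1).2 (Real.summable_one_div_nat_pow.2 (one_lt_two))
  simpa using h

theorem exists_rpow_le_exp (q : ℝ) : ∃ C : ℝ, 0 < C ∧ ∀ v : ℝ, 1 ≤ v → v ^ q ≤ C * Real.exp v := by
  obtain ⟨n, hn⟩ := exists_nat_ge q
  refine ⟨n.factorial, by positivity, fun v hv => ?_⟩
  have h1 : v ^ q ≤ v ^ n := by
    rw [← Real.rpow_natCast]
    exact Real.rpow_le_rpow_of_exponent_le hv hn
  have h2 := Real.pow_div_factorial_le_exp v (by linarith) n
  rw [div_le_iff₀ (by positivity)] at h2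
  linarith

/-- A bound for `|Č_m|` on the unit sphere of dimension `N - 1`. -/
def gegenbauerBound (N m : ℕ) : ℝ := 2 * ((m : ℝ) + 1) ^ (N - 1) / (m + 1)

theorem gegenbauerBound_nonneg (N m : ℕ) : 0 ≤ gegenbauerBound N m := by
  unfold gegenbauerBound
  positivity

/-- The power of `v` is absorbed into `exp v`. This cruder form serves only for domination under the
integral. -/
theorem exists_series_term_bound_exp {N : ℕ} (hN : 1 ≤ N) {b l : ℝ} (hb : 0 < b) (hl : -1 < l) :
    ∃ C : ℝ, 0 < C ∧ ∀ (m : ℕ) (v : ℝ), 0 ≤ v →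
      v ^ (b * m) * besselSum (b * m + l) v * gegenbauerBound N m ≤
        C * Real.exp (3 * v) * (1 / ((m : ℝ) + 1) ^ 2) := by
  obtain ⟨C, hC, h⟩ := exists_series_term_bound hN hb hl
  obtain ⟨D, hD, h'⟩ := exists_rpow_le_exp ((N : ℝ) - l)
  have hlarge : ∀ (m : ℕ) (v : ℝ), 1 ≤ v →
      v ^ (b * m) * besselSum (b * m + l) v * gegenbauerBound N m ≤
        C * (1 + D) * Real.exp (3 * v) * (1 / ((m : ℝ) + 1) ^ 2) := by
    intro m v hv
    refine (h m v (by linarith)).trans ?_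
    have h1 : 1 + v ^ ((N : ℝ) - l) ≤ (1 + D) * Real.exp v := by
      have := Real.one_le_exp (show 0 ≤ v by linarith)
      linarith [h' v hv]
    calc C * Real.exp (2 * v) * (1 + v ^ ((N : ℝ) - l)) * (1 / ((m : ℝ) + 1) ^ 2)
        ≤ C * Real.exp (2 * v) * ((1 + D) * Real.exp v) * (1 / ((m : ℝ) + 1) ^ 2) := by gcongr
      _ = _ := by
        rw [show 3 * v = 2 * v + v by ring, Real.exp_add]
        ring
  refine ⟨C * (1 + D) * Real.exp (3 * 1), by positivity, fun m v hv => ?_⟩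
  have he3 : 1 ≤ Real.exp (3 * 1) := Real.one_le_exp (by norm_num)
  rcases le_or_gt 1 v with hv1 | hv1
  · refine (hlarge m v hv1).trans ?_
    have h2 := le_mul_of_one_le_right (show 0 ≤ C * (1 + D) by positivity) he3
    exact mul_le_mul_of_nonneg_right (mul_le_mul_of_nonneg_right h2 (Real.exp_pos _).le)
      (by positivity)
  · have hμ : -1 < b * m + l := by
      have : 0 ≤ b * m := by positivity
      linarith
    have h1 := hlarge m 1 le_rfl
    rw [Real.one_rpow] at h1
    have hJ := besselSum_nonneg hμ v
    have hJ1 := besselSum_mono hμ hv hv1.le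
    have hJ2 := besselSum_nonneg hμ 1
    have hG := gegenbauerBound_nonneg N m
    have hv1 : v ^ (b * m) ≤ 1 := Real.rpow_le_one hv hv1.le (by positivity)
    calc _ ≤ 1 * besselSum (b * m + l) 1 * gegenbauerBound N m := by gcongr
      _ ≤ C * (1 + D) * Real.exp (3 * 1) * (1 / ((m : ℝ) + 1) ^ 2) := h1
      _ ≤ _ := by
        have h2 := le_mul_of_one_le_right
          (show 0 ≤ C * (1 + D) * Real.exp (3 * 1) * (1 / ((m : ℝ) + 1) ^ 2) by positivity)
          (Real.one_le_exp (show 0 ≤ 3 * v by linarith))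
        linarith

/-- The summands of the series for `𝓘(b, ν, 2 V / i, τ)`, expanded into a double series. -/
def kernelTerm (b ν V τ : ℝ) (p : ℕ × ℕ) : ℂ :=
  (-Complex.I) ^ ((b * p.1 : ℝ) : ℂ) *
    ((Real.Gamma (b * ν + 1) * V ^ (b * p.1) * ((-1) ^ p.2 * besselTerm (b * p.1 + b * ν) V p.2) *
      normGegenbauer ν p.1 τ : ℝ) : ℂ)

theorem norm_neg_I_cpow (x : ℝ) : ‖(-Complex.I) ^ (x : ℂ)‖ = 1 := by
  rw [Complex.norm_cpow_of_ne_zero (by simp)]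
  simp

theorem norm_kernelTerm {b ν V τ : ℝ} (hb : 0 < b) (hl : -1 < b * ν) (hV : 0 ≤ V) (p : ℕ × ℕ) :
    ‖kernelTerm b ν V τ p‖ = Real.Gamma (b * ν + 1) * V ^ (b * p.1) *
      besselTerm (b * p.1 + b * ν) V p.2 * |normGegenbauer ν p.1 τ| := by
  have hG : 0 < Real.Gamma (b * ν + 1) := Real.Gamma_pos_of_pos (by linarith)
  have hJ : 0 ≤ besselTerm (b * p.1 + b * ν) V p.2 := by
    apply besselTerm_nonneg
    have : 0 ≤ b * p.1 := by positivity
    linarith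
  have hVb : 0 ≤ V ^ (b * p.1) := Real.rpow_nonneg hV _
  rw [kernelTerm, norm_mul, norm_neg_I_cpow, one_mul, Complex.norm_real, Real.norm_eq_abs, abs_mul,
    abs_mul, abs_mul, abs_mul, abs_pow, abs_neg, abs_one, one_pow, one_mul, abs_of_pos hG,
    abs_of_nonneg hVb, abs_of_nonneg hJ]

theorem exists_kernelTerm_bound {N : ℕ} (hN : 1 ≤ N) {b ν : ℝ} (hb : 0 < b) (hl : -1 < b * ν) :
    ∃ K : ℝ, 0 < K ∧ ∀ V τ : ℝ, 0 ≤ V → (∀ m, |normGegenbauer ν m τ| ≤ gegenbauerBound N m) →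
      (Summable fun p => ‖kernelTerm b ν V τ p‖) ∧
      ∑' p, ‖kernelTerm b ν V τ p‖ ≤ K * Real.exp (3 * V) := by
  obtain ⟨C, hC, h⟩ := exists_series_term_bound_exp hN hb hl
  have hG : 0 < Real.Gamma (b * ν + 1) := Real.Gamma_pos_of_pos (by linarith)
  have hS := summable_one_div_succ_sq
  refine ⟨Real.Gamma (b * ν + 1) * C * ∑' m : ℕ, 1 / ((m : ℝ) + 1) ^ 2, ?_, ?_⟩
  · have : 0 < ∑' m : ℕ, 1 / ((m : ℝ) + 1) ^ 2 :=
      hS.tsum_pos (fun m => by positivity) 0 (by positivity)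
    positivity
  intro V τ hV hτ
  have hμ : ∀ m : ℕ, -1 < b * m + b * ν := fun m => by
    have : 0 ≤ b * m := by positivity
    linarith
  have hin : ∀ m : ℕ, HasSum (fun k => ‖kernelTerm b ν V τ (m, k)‖)
      (Real.Gamma (b * ν + 1) * V ^ (b * m) * besselSum (b * m + b * ν) V *
        |normGegenbauer ν m τ|) := by
    intro m
    simp_rw [norm_kernelTerm hb hl hV]
    exact ((summable_besselTerm (hμ m) V).hasSum.mul_left _).mul_right _
  have hle : ∀ m : ℕ, Real.Gamma (b * ν + 1) * V ^ (b * m) * besselSum (b * m + b * ν) V *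
        |normGegenbauer ν m τ| ≤
      Real.Gamma (b * ν + 1) * C * Real.exp (3 * V) * (1 / ((m : ℝ) + 1) ^ 2) := by
    intro m
    have hJ := besselSum_nonneg (hμ m) V
    have hVb : 0 ≤ V ^ (b * m) := Real.rpow_nonneg hV _
    calc _ ≤ Real.Gamma (b * ν + 1) * V ^ (b * m) * besselSum (b * m + b * ν) V *
          gegenbauerBound N m := by gcongr; exact hτ m
      _ = Real.Gamma (b * ν + 1) * (V ^ (b * m) * besselSum (b * m + b * ν) V *
          gegenbauerBound N m) := by ring
      _ ≤ Real.Gamma (b * ν + 1) * (C * Real.exp (3 * V) * (1 / ((m : ℝ) + 1) ^ 2)) := by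
        exact mul_le_mul_of_nonneg_left (h m V hV) hG.le
      _ = _ := by ring
  have hsum : Summable fun p => ‖kernelTerm b ν V τ p‖ := by
    refine (summable_prod_of_nonneg fun p => norm_nonneg _).2 ⟨fun m => (hin m).summable, ?_⟩
    simp_rw [fun m => (hin m).tsum_eq]
    refine Summable.of_nonneg_of_le (fun m => ?_) hle (hS.mul_left _)
    rw [← (hin m).tsum_eq]
    exact tsum_nonneg fun _ => norm_nonneg _
  refine ⟨hsum, ?_⟩
  rw [hsum.tsum_prod' fun m => (hin m).summable]
  simp_rw [fun m => (hin m).tsum_eq]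
  calc _ ≤ ∑' m : ℕ, Real.Gamma (b * ν + 1) * C * Real.exp (3 * V) * (1 / ((m : ℝ) + 1) ^ 2) := by
        refine Summable.tsum_le_tsum hle ?_ (hS.mul_left _)
        have := (summable_prod_of_nonneg fun p => norm_nonneg _).1 hsum |>.2
        simpa only [fun m => (hin m).tsum_eq] using this
    _ = _ := by rw [tsum_mul_left]; ring

/-- A nonnegative real factor does not change the argument, so the principal power splits. -/
theorem real_mul_neg_I_cpow {V : ℝ} (hV : 0 ≤ V) (x : ℝ) :
    ((V : ℂ) * -Complex.I) ^ (x : ℂ) = ((V ^ x : ℝ) : ℂ) * (-Complex.I) ^ (x : ℂ) := by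
  have hI : -Complex.I ≠ 0 := by simp
  rcases eq_or_lt_of_le hV with rfl | hV0
  · rcases eq_or_ne x 0 with rfl | hx
    · simp
    · rw [Complex.ofReal_zero, zero_mul, Complex.zero_cpow (by exact_mod_cast hx),
        Real.zero_rpow hx]
      simp
  · have hVc : (V : ℂ) ≠ 0 := by exact_mod_cast hV0.ne'
    rw [Complex.cpow_def_of_ne_zero (mul_ne_zero hVc hI), Complex.log_ofReal_mul hV0 hI, add_mul,
      Complex.exp_add, Complex.ofReal_cpow hV, Complex.cpow_def_of_ne_zero hVc,
      Complex.cpow_def_of_ne_zero hI, Complex.ofReal_log hV]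

theorem normBesselI_imaginary (μ V : ℝ) :
    normBesselI μ (2 * ((V : ℂ) * -Complex.I)) =
      ∑' k, (((-1) ^ k * besselTerm μ V k : ℝ) : ℂ) := by
  rw [normBesselI]
  refine tsum_congr fun k => ?_
  rw [besselTerm, mul_div_cancel_left₀ _ two_ne_zero, mul_pow, pow_mul (-Complex.I), neg_sq,
    Complex.I_sq]
  push_cast
  ring

theorem hasSum_kernelTerm {b ν V τ : ℝ} (hV : 0 ≤ V)
    (hs : Summable fun p => ‖kernelTerm b ν V τ p‖) :
    HasSum (kernelTerm b ν V τ) (scrI b ν (2 * ((V : ℂ) * -Complex.I)) τ) := by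
  have hs' : Summable (kernelTerm b ν V τ) := hs.of_norm
  have : scrI b ν (2 * ((V : ℂ) * -Complex.I)) τ = ∑' p, kernelTerm b ν V τ p := by
    rw [hs'.tsum_prod, scrI, ← tsum_mul_left]
    refine tsum_congr fun m => ?_
    rw [normBesselI_imaginary, mul_div_cancel_left₀ _ two_ne_zero, real_mul_neg_I_cpow hV,
      ← tsum_mul_left, ← tsum_mul_right, ← tsum_mul_left]
    refine tsum_congr fun k => ?_
    rw [kernelTerm, mul_add]
    push_cast
    ring
  rw [this]
  exact hs'.hasSum

/-- Since `b > 0`, only the term `m = 0` survives, and `Č_0 = 1`. This permits an arbitrary choice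
of direction for the zero vector. -/
theorem scrI_zero {b : ℝ} (hb : 0 < b) (ν τ τ' : ℝ) : scrI b ν 0 τ = scrI b ν 0 τ' := by
  rw [scrI, scrI]
  congr 1
  refine tsum_congr fun m => ?_
  rcases m with _ | m
  · rw [normGegenbauer_zero, normGegenbauer_zero]
  · have : ((b * ((m + 1 : ℕ) : ℝ) : ℝ) : ℂ) ≠ 0 := by
      norm_cast
      positivity
    rw [zero_div, Complex.zero_cpow this]
    simp

/-! ### Integrability and radial integrals. -/

/-- Dominated convergence for series, with a bound on the sum of the norms. -/
theorem hasSum_integral_of_tsum_norm_le {α ι : Type*} [MeasurableSpace α] {μ : Measure α}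
    [Countable ι] {F : ι → α → ℂ} {f : α → ℂ} {g : α → ℝ}
    (hF : ∀ i, AEStronglyMeasurable (F i) μ) (hg : Integrable g μ)
    (hs : ∀ᵐ a ∂μ, Summable fun i => ‖F i a‖) (hle : ∀ᵐ a ∂μ, ∑' i, ‖F i a‖ ≤ g a)
    (hf : ∀ᵐ a ∂μ, HasSum (fun i => F i a) (f a)) :
    Integrable f μ ∧ HasSum (fun i => ∫ a, F i a ∂μ) (∫ a, f a ∂μ) := by
  have hm : AEStronglyMeasurable (fun a => ∑' i, ‖F i a‖) μ := by
    refine aestronglyMeasurable_of_tendsto_ae Filter.atTop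
      (f := fun (s : Finset ι) a => ∑ i ∈ s, ‖F i a‖) (fun s => ?_)
      (hs.mono fun a ha => ha.hasSum)
    exact Finset.aestronglyMeasurable_fun_sum s fun i _ => (hF i).norm
  have hi : Integrable (fun a => ∑' i, ‖F i a‖) μ := by
    refine hg.mono' hm (hle.mono fun a ha => ?_)
    rwa [Real.norm_of_nonneg (tsum_nonneg fun _ => norm_nonneg _)]
  refine ⟨?_, hasSum_integral_of_dominated_convergence (fun i a => ‖F i a‖) hF
    (fun i => Filter.Eventually.of_forall fun a => le_rfl) hs hi hf⟩
  have hfm : AEStronglyMeasurable f μ := by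
    refine aestronglyMeasurable_of_tendsto_ae Filter.atTop
      (f := fun (s : Finset ι) a => ∑ i ∈ s, F i a) (fun s => ?_) (hf.mono fun a ha => ha)
    exact Finset.aestronglyMeasurable_fun_sum s fun i _ => hF i
  refine hi.mono' hfm ?_
  filter_upwards [hs, hf] with a h1 h2
  rw [← h2.tsum_eq]
  exact norm_tsum_le_tsum_norm h1

/-- Completing the square absorbs the linear growth and keeps half of the quadratic decay. -/
theorem exp_quadratic_le {κ c u : ℝ} (hc : 0 < c) :
    Real.exp (κ * u) * Real.exp (-c * u ^ 2) ≤
      Real.exp (κ ^ 2 / (2 * c)) * Real.exp (-(c / 2) * u ^ 2) := by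
  rw [← Real.exp_add, ← Real.exp_add, Real.exp_le_exp]
  have h : 0 ≤ (κ - c * u) ^ 2 / (2 * c) := by positivity
  have h2 : (κ - c * u) ^ 2 / (2 * c) = κ ^ 2 / (2 * c) - κ * u + c / 2 * u ^ 2 := by
    field_simp
    ring
  linarith

/-- In polar coordinates the power at the origin is `ρ ^ (N + a - 3)`, integrable precisely because
`a > 2 - N`. -/
theorem integrable_exp_neg_norm_rpow {N : ℕ} (hN : 1 ≤ N) {a c : ℝ} (ha : 0 < a)
    (ha2 : 2 - (N : ℝ) < a) (hc : 0 < c) :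
    Integrable fun ξ : EuclideanSpace ℝ (Fin N) =>
      Real.exp (-c * ‖ξ‖ ^ a) * ‖ξ‖ ^ (a - 2) := by
  have : Nonempty (Fin N) := ⟨⟨0, hN⟩⟩
  rw [integrable_fun_norm_addHaar volume (f := fun ρ => Real.exp (-c * ρ ^ a) * ρ ^ (a - 2)),
    finrank_euclideanSpace_fin]
  have h := integrableOn_rpow_mul_exp_neg_mul_rpow (s := (N : ℝ) - 1 + (a - 2)) (p := a) (b := c)
    (by linarith) ha hc
  refine h.congr_fun (fun ρ hρ => ?_) measurableSet_Ioi
  have hρ' : (0 : ℝ) < ρ := hρ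
  simp only [smul_eq_mul]
  rw [Real.rpow_add hρ', ← Nat.cast_pred hN, Real.rpow_natCast]
  ring

/-- The radial integrals in the series for the heat kernel. -/
theorem integral_radial_bessel {N : ℕ} (hN : 1 ≤ N) {a t R S l : ℝ} (ha : 0 < a) (ht : 0 < t)
    (hl : -1 < l) (hal : a * l = N - 2) (hR : 0 ≤ R) (hS : 0 ≤ S) (m k k' : ℕ) :
    ∫ ρ in Set.Ioi (0 : ℝ), (ρ : ℝ) ^ (N - 1) •
      ((R * ρ ^ (a / 2)) ^ (2 / a * m) * besselTerm (2 / a * m + l) (R * ρ ^ (a / 2)) k *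
        ((S * ρ ^ (a / 2)) ^ (2 / a * m) * besselTerm (2 / a * m + l) (S * ρ ^ (a / 2)) k') *
        (Real.exp (-(t / a) * ρ ^ a) * ρ ^ (a - 2))) =
      1 / a * (t / a) ^ (-(l + 1)) * (R * S * a / t) ^ (2 / a * m) *
        ((R ^ 2 * a / t) ^ k * (S ^ 2 * a / t) ^ k' *
          (Real.Gamma (2 / a * m + l + k + k' + 1) / (k.factorial * k'.factorial *
            Real.Gamma (2 / a * m + l + k + 1) * Real.Gamma (2 / a * m + l + k' + 1)))) := by
  set μ := 2 / a * m + l with hμdef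
  have hm0 : 0 ≤ 2 / a * (m : ℝ) := by positivity
  have hμ : -1 < μ := by linarith
  have hk : (0 : ℝ) ≤ k := k.cast_nonneg
  have hk' : (0 : ℝ) ≤ k' := k'.cast_nonneg
  have hta : 0 < t / a := by positivity
  -- All powers of `ρ` collect to `N - 1 + 2 m + a k + a k' + a - 2`, which is this exponent because
  -- `a l = N - 2`.
  set q : ℝ := a * (μ + k + k' + 1) - 1 with hq
  have hq1 : -1 < q := by
    have : 0 < a * (μ + k + k' + 1) := mul_pos ha (by linarith)
    linarith
  have h := integral_rpow_mul_exp_neg_mul_rpow (p := a) (q := q) ha hq1 hta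
  have e1 : (q + 1) / a = μ + k + k' + 1 := by rw [hq]; field_simp; ring
  rw [neg_div, e1] at h
  set c : ℝ := R ^ (2 / a * (m : ℝ)) * S ^ (2 / a * (m : ℝ)) * R ^ (2 * k) * S ^ (2 * k') /
    (k.factorial * Real.Gamma (μ + k + 1) * (k'.factorial * Real.Gamma (μ + k' + 1))) with hc
  trans c * ((t / a) ^ (-(μ + k + k' + 1)) * (1 / a) * Real.Gamma (μ + k + k' + 1))
  · rw [← h, ← integral_const_mul]
    refine setIntegral_congr_fun measurableSet_Ioi fun ρ hρ => ?_
    have hρ' : (0 : ℝ) < ρ := hρ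
    have hρa : 0 ≤ ρ ^ (a / 2) := Real.rpow_nonneg hρ'.le _
    simp only [smul_eq_mul, besselTerm]
    rw [Real.mul_rpow hR hρa, Real.mul_rpow hS hρa, ← Real.rpow_mul hρ'.le,
      show a / 2 * (2 / a * (m : ℝ)) = m by field_simp, Real.rpow_natCast, mul_pow, mul_pow,
      ← Real.rpow_mul_natCast hρ'.le, ← Real.rpow_mul_natCast hρ'.le]
    have e2 : q = ((N - 1 : ℕ) : ℝ) + m + m + (a / 2 * ((2 * k : ℕ) : ℝ)) +
        (a / 2 * ((2 * k' : ℕ) : ℝ)) + (a - 2) := by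
      rw [hq, hμdef, Nat.cast_pred hN]
      push_cast
      have : a * (2 / a * (m : ℝ)) = 2 * m := by field_simp
      linear_combination this + hal
    rw [e2, Real.rpow_add hρ', Real.rpow_add hρ', Real.rpow_add hρ', Real.rpow_add hρ',
      Real.rpow_add hρ', Real.rpow_natCast, Real.rpow_natCast, hc]
    ring
  · have e3 : (t / a) ^ (-(μ + k + k' + 1)) = (t / a) ^ (-(l + 1)) *
        (a / t) ^ (2 / a * (m : ℝ)) * (a / t) ^ k * (a / t) ^ k' := by
      rw [← Real.rpow_natCast, ← Real.rpow_natCast, ← inv_div t a, Real.inv_rpow hta.le,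
        Real.inv_rpow hta.le, Real.inv_rpow hta.le, ← Real.rpow_neg hta.le, ← Real.rpow_neg hta.le,
        ← Real.rpow_neg hta.le, ← Real.rpow_add hta, ← Real.rpow_add hta, ← Real.rpow_add hta]
      congr 1
      rw [hμdef]
      ring
    have e4 : (R * S * a / t) ^ (2 / a * (m : ℝ)) = R ^ (2 / a * (m : ℝ)) *
        S ^ (2 / a * (m : ℝ)) * (a / t) ^ (2 / a * (m : ℝ)) := by
      rw [mul_div_assoc, Real.mul_rpow (by positivity) (by positivity), Real.mul_rpow hR hS]
    rw [e3, e4, hc, mul_div_assoc (R ^ 2), mul_div_assoc (S ^ 2), mul_pow, mul_pow, ← pow_mul,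
      ← pow_mul]
    ring

/-! ### Termwise integration of the heat kernel. -/

theorem sphereIndex_euclideanSpace (N : ℕ) :
    sphereIndex (EuclideanSpace ℝ (Fin N)) = ((N : ℝ) - 2) / 2 := by
  simp only [sphereIndex, finrank_euclideanSpace_fin]
  ring

theorem abs_normGegenbauer_le_gegenbauerBound {N : ℕ} (hN : 1 ≤ N)
    {ω u : EuclideanSpace ℝ (Fin N)} (hω : ‖ω‖ = 1) (hu : ‖u‖ = 1) (m : ℕ) :
    |normGegenbauer (((N : ℝ) - 2) / 2) m (inner ℝ ω u)| ≤ gegenbauerBound N m := by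
  have : Nonempty (Fin N) := ⟨⟨0, hN⟩⟩
  have h1 := abs_normGegenbauer_le hω hu m
  have h2 := normGegenbauer_at_one_mul_le hN m
  rw [sphereIndex_euclideanSpace] at h1
  rw [show (N : ℝ) / 2 - 1 = ((N : ℝ) - 2) / 2 by ring] at h2
  refine h1.trans ?_
  rwa [gegenbauerBound, le_div_iff₀ (by positivity)]

theorem exists_unit_smul_eq {N : ℕ} (hN : 1 ≤ N) (x : EuclideanSpace ℝ (Fin N)) :
    ∃ ω : EuclideanSpace ℝ (Fin N), ‖ω‖ = 1 ∧ x = ‖x‖ • ω := by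
  have : Nonempty (Fin N) := ⟨⟨0, hN⟩⟩
  rcases eq_or_ne x 0 with rfl | hx
  · obtain ⟨ω, hω⟩ := exists_norm_eq (EuclideanSpace ℝ (Fin N)) zero_le_one
    exact ⟨ω, hω, by simp⟩
  · have h0 : ‖x‖ ≠ 0 := norm_ne_zero_iff.2 hx
    exact ⟨‖x‖⁻¹ • x, by rw [norm_smul, norm_inv, norm_norm, inv_mul_cancel₀ h0],
      by rw [smul_smul, mul_inv_cancel₀ h0, one_smul]⟩

theorem fourierKernel_eq_scrI {N : ℕ} {a : ℝ} (ha : 0 < a) {x ω : EuclideanSpace ℝ (Fin N)}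
    (hx : x = ‖x‖ • ω) (ξ : EuclideanSpace ℝ (Fin N)) :
    fourierKernel N a x ξ = scrI (2 / a) (((N : ℝ) - 2) / 2)
      (2 * (((‖x‖ ^ (a / 2) / a * ‖ξ‖ ^ (a / 2) : ℝ) : ℂ) * -Complex.I))
      (inner ℝ ω (‖ξ‖⁻¹ • ξ)) := by
  have hw : 2 * (((‖x‖ * ‖ξ‖) ^ (a / 2) : ℝ) : ℂ) / ((a : ℂ) * Complex.I) =
      2 * (((‖x‖ ^ (a / 2) / a * ‖ξ‖ ^ (a / 2) : ℝ) : ℂ) * -Complex.I) := by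
    rw [Real.mul_rpow (norm_nonneg _) (norm_nonneg _)]
    have h1 : (a : ℂ) ≠ 0 := by exact_mod_cast ha.ne'
    have h2 := Complex.I_ne_zero
    push_cast
    field_simp
    rw [Complex.I_sq]
    ring
  rw [fourierKernel, hw]
  rcases eq_or_ne ‖x‖ 0 with h0 | h0
  · rw [h0, Real.zero_rpow (by positivity)]
    simp only [zero_div, zero_mul, Complex.ofReal_zero, mul_zero]
    exact scrI_zero (by positivity) _ _ _
  · congr 1
    rw [inner_smul_right]
    conv_lhs => rw [hx, inner_smul_left]
    simp only [conj_trivial]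
    have : ‖‖x‖ • ω‖ = ‖x‖ := by rw [← hx]
    rw [this]
    field_simp

/-- The summands of the series for the Fourier kernel at the point `x = r ω` with
`R = r ^ (a / 2) / a`. -/
def fourierTerm (N : ℕ) (a R : ℝ) (ω : EuclideanSpace ℝ (Fin N)) (p : ℕ × ℕ)
    (ξ : EuclideanSpace ℝ (Fin N)) : ℂ :=
  kernelTerm (2 / a) (((N : ℝ) - 2) / 2) (R * ‖ξ‖ ^ (a / 2)) (inner ℝ ω (‖ξ‖⁻¹ • ξ)) p

/-- The summands of the series for the integrand of the heat kernel. -/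
def heatTerm (N : ℕ) (a t R S : ℝ) (ω u : EuclideanSpace ℝ (Fin N)) (p : (ℕ × ℕ) × (ℕ × ℕ))
    (ξ : EuclideanSpace ℝ (Fin N)) : ℂ :=
  (starRingEnd ℂ) (fourierTerm N a R ω p.1 ξ) * fourierTerm N a S u p.2 ξ *
    ((Real.exp (-(t / a) * ‖ξ‖ ^ a) * ‖ξ‖ ^ (a - 2) : ℝ) : ℂ)

theorem measurable_fourierTerm (N : ℕ) (a R : ℝ) (ω : EuclideanSpace ℝ (Fin N)) (p : ℕ × ℕ) :
    Measurable (fourierTerm N a R ω p) := by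
  have hc := (continuous_normGegenbauer (((N : ℝ) - 2) / 2) p.1).measurable
  have h1 : Measurable fun ξ : EuclideanSpace ℝ (Fin N) => inner ℝ ω (‖ξ‖⁻¹ • ξ) := by fun_prop
  have h2 : Measurable fun ξ : EuclideanSpace ℝ (Fin N) => R * ‖ξ‖ ^ (a / 2) :=
    (measurable_norm.pow_const _).const_mul _
  have h3 := hc.comp h1
  have h4 : Measurable fun ξ : EuclideanSpace ℝ (Fin N) =>
      (R * ‖ξ‖ ^ (a / 2)) ^ (2 / a * (p.1 : ℝ)) := h2.pow_const _
  have h5 : Measurable fun ξ : EuclideanSpace ℝ (Fin N) => besselTerm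
      (2 / a * p.1 + 2 / a * (((N : ℝ) - 2) / 2)) (R * ‖ξ‖ ^ (a / 2)) p.2 :=
    (h2.pow_const _).div_const _
  exact (Complex.measurable_ofReal.comp (((h4.const_mul _).mul (h5.const_mul _)).mul h3)).const_mul _

theorem measurable_heatTerm (N : ℕ) (a t R S : ℝ) (ω u : EuclideanSpace ℝ (Fin N))
    (p : (ℕ × ℕ) × (ℕ × ℕ)) : Measurable (heatTerm N a t R S ω u p) := by
  have h1 := Complex.continuous_conj.measurable.comp (measurable_fourierTerm N a R ω p.1)
  have h2 := measurable_fourierTerm N a S u p.2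
  have h3 : Measurable fun ξ : EuclideanSpace ℝ (Fin N) =>
      Real.exp (-(t / a) * ‖ξ‖ ^ a) * ‖ξ‖ ^ (a - 2) :=
    (Real.measurable_exp.comp ((measurable_norm.pow_const _).const_mul _)).mul
      (measurable_norm.pow_const _)
  exact (h1.mul h2).mul (Complex.measurable_ofReal.comp h3)

/-- The standing numerical facts about the parameters. -/
theorem parameters {N : ℕ} {a : ℝ} (ha : max 0 (2 - (N : ℝ)) < a) :
    0 < a ∧ 2 - (N : ℝ) < a ∧ -1 < 2 / a * (((N : ℝ) - 2) / 2) ∧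
      a * (2 / a * (((N : ℝ) - 2) / 2)) = N - 2 := by
  have h0 : 0 < a := (le_max_left _ _).trans_lt ha
  have h1 : 2 - (N : ℝ) < a := (le_max_right _ _).trans_lt ha
  have h2 : a * (2 / a * (((N : ℝ) - 2) / 2)) = N - 2 := by field_simp
  refine ⟨h0, h1, ?_, h2⟩
  by_contra h
  rw [not_lt] at h
  have := mul_le_mul_of_nonneg_left h h0.le
  linarith

/-- The sum of the norms of the terms is at most the product of two bounds `K exp (3 V)` and the
weight. Completing the square turns this into an integrable majorant. -/
theorem heatIntegrand_hasSum {N : ℕ} (hN : 1 ≤ N) {a : ℝ} (ha : max 0 (2 - (N : ℝ)) < a)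
    {t : ℝ} (ht : 0 < t) {x y ω u : EuclideanSpace ℝ (Fin N)} (hω : ‖ω‖ = 1) (hu : ‖u‖ = 1)
    (hx : x = ‖x‖ • ω) (hy : y = ‖y‖ • u) :
    Integrable (heatIntegrand N a x y t) volume ∧
      HasSum (fun p => ∫ ξ, heatTerm N a t (‖x‖ ^ (a / 2) / a) (‖y‖ ^ (a / 2) / a) ω u p ξ)
        (∫ ξ, heatIntegrand N a x y t ξ) := by
  obtain ⟨h0, h1, hl, hal⟩ := parameters ha
  have hb : 0 < 2 / a := by positivity
  obtain ⟨K, hK, hKb⟩ := exists_kernelTerm_bound hN hb hl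
  have : Nonempty (Fin N) := ⟨⟨0, hN⟩⟩
  have hc : 0 < t / a := by positivity
  set R := ‖x‖ ^ (a / 2) / a with hR
  set S := ‖y‖ ^ (a / 2) / a with hS
  have hR0 : 0 ≤ R := by positivity
  have hS0 : 0 ≤ S := by positivity
  -- The bound on `Č_m` needs `‖ξ‖⁻¹ • ξ` to be a unit vector, which fails only at the origin.
  have hne : ∀ᵐ ξ : EuclideanSpace ℝ (Fin N), ξ ≠ 0 :=
    compl_mem_ae_iff.2 (measure_singleton 0)
  have hunit : ∀ ξ : EuclideanSpace ℝ (Fin N), ξ ≠ 0 → ‖‖ξ‖⁻¹ • ξ‖ = 1 := fun ξ hξ => by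
    rw [norm_smul, norm_inv, norm_norm, inv_mul_cancel₀ (norm_ne_zero_iff.2 hξ)]
  have key : ∀ (T : ℝ) (z : EuclideanSpace ℝ (Fin N)), 0 ≤ T → ‖z‖ = 1 →
      ∀ ξ : EuclideanSpace ℝ (Fin N), ξ ≠ 0 → (Summable fun p => ‖fourierTerm N a T z p ξ‖) ∧
        ∑' p, ‖fourierTerm N a T z p ξ‖ ≤ K * Real.exp (3 * (T * ‖ξ‖ ^ (a / 2))) := by
    intro T z hT hz ξ hξ
    exact hKb _ _ (by positivity)
      (fun m => abs_normGegenbauer_le_gegenbauerBound hN hz (hunit ξ hξ) m)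
  have hnorm : ∀ p ξ, ‖heatTerm N a t R S ω u p ξ‖ =
      ‖fourierTerm N a R ω p.1 ξ‖ * ‖fourierTerm N a S u p.2 ξ‖ *
        (Real.exp (-(t / a) * ‖ξ‖ ^ a) * ‖ξ‖ ^ (a - 2)) := by
    intro p ξ
    rw [heatTerm, norm_mul, norm_mul, RCLike.norm_conj, Complex.norm_real, Real.norm_of_nonneg]
    positivity
  have hpair : ∀ ξ : EuclideanSpace ℝ (Fin N), ξ ≠ 0 →
      HasSum (fun p => ‖heatTerm N a t R S ω u p ξ‖)
        ((∑' p, ‖fourierTerm N a R ω p ξ‖) * (∑' p, ‖fourierTerm N a S u p ξ‖) *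
          (Real.exp (-(t / a) * ‖ξ‖ ^ a) * ‖ξ‖ ^ (a - 2))) := by
    intro ξ hξ
    simp_rw [hnorm]
    have s1 := (key R ω hR0 hω ξ hξ).1
    have s2 := (key S u hS0 hu ξ hξ).1
    exact (hasSum_mul_of_summable_norm s1.hasSum s2.hasSum s1.norm s2.norm).mul_right _
  set κ := 3 * (R + S) with hκ
  refine hasSum_integral_of_tsum_norm_le
    (g := fun ξ => K ^ 2 * Real.exp (κ ^ 2 / (2 * (t / a))) *
      (Real.exp (-(t / a / 2) * ‖ξ‖ ^ a) * ‖ξ‖ ^ (a - 2)))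
    (fun p => (measurable_heatTerm N a t R S ω u p).aestronglyMeasurable)
    ((integrable_exp_neg_norm_rpow hN h0 h1 (by positivity)).const_mul _) ?_ ?_ ?_
  · filter_upwards [hne] with ξ hξ
    exact (hpair ξ hξ).summable
  · filter_upwards [hne] with ξ hξ
    rw [(hpair ξ hξ).tsum_eq]
    have b1 := (key R ω hR0 hω ξ hξ).2
    have b2 := (key S u hS0 hu ξ hξ).2
    have n2 : 0 ≤ ∑' p, ‖fourierTerm N a S u p ξ‖ := tsum_nonneg fun _ => norm_nonneg _
    have hsq : (‖ξ‖ ^ (a / 2)) ^ 2 = ‖ξ‖ ^ a := by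
      rw [← Real.rpow_mul_natCast (norm_nonneg _)]
      congr 1
      push_cast
      ring
    have hq := exp_quadratic_le (κ := κ) (u := ‖ξ‖ ^ (a / 2)) hc
    rw [hsq] at hq
    calc _ ≤ (K * Real.exp (3 * (R * ‖ξ‖ ^ (a / 2)))) * (K * Real.exp (3 * (S * ‖ξ‖ ^ (a / 2)))) *
          (Real.exp (-(t / a) * ‖ξ‖ ^ a) * ‖ξ‖ ^ (a - 2)) := by gcongr
      _ = K ^ 2 * (Real.exp (κ * ‖ξ‖ ^ (a / 2)) * Real.exp (-(t / a) * ‖ξ‖ ^ a)) *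
          ‖ξ‖ ^ (a - 2) := by
        rw [show κ * ‖ξ‖ ^ (a / 2) = 3 * (R * ‖ξ‖ ^ (a / 2)) + 3 * (S * ‖ξ‖ ^ (a / 2)) by
          rw [hκ]; ring, Real.exp_add]
        ring
      _ ≤ K ^ 2 * (Real.exp (κ ^ 2 / (2 * (t / a))) * Real.exp (-(t / a / 2) * ‖ξ‖ ^ a)) *
          ‖ξ‖ ^ (a - 2) := by gcongr
      _ = _ := by ring
  · filter_upwards [hne] with ξ hξ
    have s1 := (key R ω hR0 hω ξ hξ).1
    have s2 := (key S u hS0 hu ξ hξ).1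
    have k1 : HasSum (fun p => fourierTerm N a R ω p ξ) (fourierKernel N a x ξ) := by
      rw [fourierKernel_eq_scrI h0 hx]
      exact hasSum_kernelTerm (by positivity) s1
    have k2 : HasSum (fun p => fourierTerm N a S u p ξ) (fourierKernel N a y ξ) := by
      rw [fourierKernel_eq_scrI h0 hy]
      exact hasSum_kernelTerm (by positivity) s2
    have k1' : HasSum (fun p => (starRingEnd ℂ) (fourierTerm N a R ω p ξ))
        ((starRingEnd ℂ) (fourierKernel N a x ξ)) := Complex.hasSum_conj'.2 k1
    have s1' : Summable fun p => ‖(starRingEnd ℂ) (fourierTerm N a R ω p ξ)‖ := by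
      simpa only [RCLike.norm_conj] using s1
    exact (hasSum_mul_of_summable_norm k1' k2 s1' s2).mul_right _

theorem integral_gegenbauer_mul_gegenbauer {N : ℕ} (hN : 1 ≤ N)
    {ω u : EuclideanSpace ℝ (Fin N)} (hω : ‖ω‖ = 1) (hu : ‖u‖ = 1) (m n : ℕ) :
    ∫ η : Metric.sphere (0 : EuclideanSpace ℝ (Fin N)) 1,
      normGegenbauer (((N : ℝ) - 2) / 2) m (inner ℝ ω (η : EuclideanSpace ℝ (Fin N))) *
        normGegenbauer (((N : ℝ) - 2) / 2) n (inner ℝ u (η : EuclideanSpace ℝ (Fin N)))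
        ∂(volume : Measure (EuclideanSpace ℝ (Fin N))).toSphere =
      if m = n then (volume : Measure (EuclideanSpace ℝ (Fin N))).toSphere.real Set.univ *
        normGegenbauer (((N : ℝ) - 2) / 2) m (inner ℝ ω u) else 0 := by
  have : Nonempty (Fin N) := ⟨⟨0, hN⟩⟩
  have h1 := sphereMean_gegenbauer_mul_gegenbauer hω hu m n
  have h2 := toSphere_real_univ_pos (E := EuclideanSpace ℝ (Fin N))
  rw [sphereIndex_euclideanSpace, sphereMean, inv_mul_eq_iff_eq_mul₀ h2.ne'] at h1
  rw [h1]
  split_ifs <;> simp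

/-- The summands of the series for the heat kernel. -/
def heatCoeff (N : ℕ) (a t R S τ : ℝ) (q : ℕ × (ℕ × ℕ)) : ℝ :=
  (volume : Measure (EuclideanSpace ℝ (Fin N))).toSphere.real Set.univ *
    Real.Gamma (2 / a * (((N : ℝ) - 2) / 2) + 1) ^ 2 * (1 / a) *
    (t / a) ^ (-(2 / a * (((N : ℝ) - 2) / 2) + 1)) *
    ((R * S * a / t) ^ (2 / a * (q.1 : ℝ)) * normGegenbauer (((N : ℝ) - 2) / 2) q.1 τ) *
    ((-(R ^ 2 * a / t)) ^ q.2.1 * (-(S ^ 2 * a / t)) ^ q.2.2 *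
      (Real.Gamma (2 / a * q.1 + 2 / a * (((N : ℝ) - 2) / 2) + q.2.1 + q.2.2 + 1) /
        (q.2.1.factorial * q.2.2.factorial *
        Real.Gamma (2 / a * q.1 + 2 / a * (((N : ℝ) - 2) / 2) + q.2.1 + 1) *
        Real.Gamma (2 / a * q.1 + 2 / a * (((N : ℝ) - 2) / 2) + q.2.2 + 1))))

/-- Each term separates in polar coordinates: the sphere contributes the reproducing property, the
radius a Gamma integral. -/
theorem integral_heatTerm {N : ℕ} (hN : 1 ≤ N) {a : ℝ} (ha : max 0 (2 - (N : ℝ)) < a)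
    {t R S : ℝ} (ht : 0 < t) (hR : 0 ≤ R) (hS : 0 ≤ S) {ω u : EuclideanSpace ℝ (Fin N)}
    (hω : ‖ω‖ = 1) (hu : ‖u‖ = 1) (m n k l : ℕ) :
    ∫ ξ, heatTerm N a t R S ω u ((m, k), (n, l)) ξ =
      if m = n then (heatCoeff N a t R S (inner ℝ ω u) (m, (k, l)) : ℂ) else 0 := by
  have : Nonempty (Fin N) := ⟨⟨0, hN⟩⟩
  obtain ⟨h0, h1, hl, hal⟩ := parameters ha
  set b := 2 / a with hb
  set ν := ((N : ℝ) - 2) / 2 with hν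
  set G := Real.Gamma (b * ν + 1) with hG
  let f : ℝ → ℂ := fun ρ =>
    ((starRingEnd ℂ) ((-Complex.I) ^ ((b * m : ℝ) : ℂ)) * (-Complex.I) ^ ((b * n : ℝ) : ℂ)) *
    ((G ^ 2 * ((-1) ^ k * (-1) ^ l) : ℝ) : ℂ) *
    (((R * ρ ^ (a / 2)) ^ (b * m) * besselTerm (b * m + b * ν) (R * ρ ^ (a / 2)) k *
        ((S * ρ ^ (a / 2)) ^ (b * n) * besselTerm (b * n + b * ν) (S * ρ ^ (a / 2)) l) *
        (Real.exp (-(t / a) * ρ ^ a) * ρ ^ (a - 2)) : ℝ) : ℂ)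
  let g : Metric.sphere (0 : EuclideanSpace ℝ (Fin N)) 1 → ℂ := fun η =>
    ((normGegenbauer ν m (inner ℝ ω (η : EuclideanSpace ℝ (Fin N))) *
        normGegenbauer ν n (inner ℝ u (η : EuclideanSpace ℝ (Fin N))) : ℝ) : ℂ)
  have hpolar := integral_polar_mul (heatTerm N a t R S ω u ((m, k), (n, l))) f g (by
    intro η ρ hρ
    have hη : ‖(η : EuclideanSpace ℝ (Fin N))‖ = 1 := by simp
    have hρn : ‖ρ • (η : EuclideanSpace ℝ (Fin N))‖ = ρ := by
      rw [norm_smul, hη, mul_one, Real.norm_of_nonneg hρ.le]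
    simp only [heatTerm, fourierTerm, kernelTerm, hρn, smul_smul, inv_mul_cancel₀ hρ.ne', one_smul,
      map_mul, Complex.conj_ofReal, f, g]
    rw [← hb, ← hν, ← hG]
    push_cast
    ring)
  have hg : ∫ η, g η ∂(volume : Measure (EuclideanSpace ℝ (Fin N))).toSphere =
      ((if m = n then (volume : Measure (EuclideanSpace ℝ (Fin N))).toSphere.real Set.univ *
        normGegenbauer ν m (inner ℝ ω u) else 0 : ℝ) : ℂ) := by
    rw [← integral_gegenbauer_mul_gegenbauer hN hω hu m n]
    exact integral_ofReal
  rw [hpolar, hg]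
  by_cases hmn : m = n
  · subst hmn
    rw [if_pos rfl, if_pos rfl]
    -- The phase has modulus one, so for equal degrees it cancels against its conjugate and the
    -- coefficient becomes real.
    have hphase : (starRingEnd ℂ) ((-Complex.I) ^ ((b * m : ℝ) : ℂ)) *
        (-Complex.I) ^ ((b * m : ℝ) : ℂ) = 1 := by
      rw [← Complex.normSq_eq_conj_mul_self, Complex.normSq_eq_norm_sq, norm_neg_I_cpow]
      simp
    have hrad := integral_radial_bessel hN h0 ht hl hal hR hS m k l
    have hf : ∫ ρ in Set.Ioi (0 : ℝ),
        (ρ : ℝ) ^ (Module.finrank ℝ (EuclideanSpace ℝ (Fin N)) - 1) • f ρ =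
        ((G ^ 2 * ((-1) ^ k * (-1) ^ l) : ℝ) : ℂ) *
          ((∫ ρ in Set.Ioi (0 : ℝ), (ρ : ℝ) ^ (N - 1) •
      ((R * ρ ^ (a / 2)) ^ (b * m) * besselTerm (b * m + b * ν) (R * ρ ^ (a / 2)) k *
        ((S * ρ ^ (a / 2)) ^ (b * m) * besselTerm (b * m + b * ν) (S * ρ ^ (a / 2)) l) *
        (Real.exp (-(t / a) * ρ ^ a) * ρ ^ (a - 2))) : ℝ) : ℂ) := by
      rw [← integral_complex_ofReal, ← integral_const_mul]
      refine setIntegral_congr_fun measurableSet_Ioi fun ρ _ => ?_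
      simp only [f, hphase, one_mul, finrank_euclideanSpace_fin, Complex.real_smul, smul_eq_mul]
      push_cast
      ring
    rw [hf, hrad, heatCoeff]
    simp only
    rw [← hb, ← hν, ← hG, neg_pow (R ^ 2 * a / t), neg_pow (S ^ 2 * a / t)]
    push_cast
    ring
  · rw [if_neg hmn, if_neg hmn]
    simp

/-- The integral defining the heat kernel as a convergent real series. -/
theorem hasSum_heatCoeff {N : ℕ} (hN : 1 ≤ N) {a : ℝ} (ha : max 0 (2 - (N : ℝ)) < a)
    {t : ℝ} (ht : 0 < t) {x y ω u : EuclideanSpace ℝ (Fin N)} (hω : ‖ω‖ = 1) (hu : ‖u‖ = 1)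
    (hx : x = ‖x‖ • ω) (hy : y = ‖y‖ • u) :
    HasSum (fun q => (heatCoeff N a t (‖x‖ ^ (a / 2) / a) (‖y‖ ^ (a / 2) / a) (inner ℝ ω u) q : ℂ))
      (∫ ξ, heatIntegrand N a x y t ξ) := by
  have h0 := (parameters ha).1
  have h := (heatIntegrand_hasSum hN ha ht hω hu hx hy).2
  have hR0 : 0 ≤ ‖x‖ ^ (a / 2) / a := by positivity
  have hS0 : 0 ≤ ‖y‖ ^ (a / 2) / a := by positivity
  -- The embedding of equal Gegenbauer degrees; all other terms integrate to zero.
  let e : ℕ × (ℕ × ℕ) → (ℕ × ℕ) × (ℕ × ℕ) := fun q => ((q.1, q.2.1), (q.1, q.2.2))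
  have he : Function.Injective e := by
    rintro ⟨m, k, l⟩ ⟨m', k', l'⟩ h
    simp only [e, Prod.mk.injEq] at h ⊢
    tauto
  rw [← he.hasSum_iff] at h
  · refine h.congr_fun ?_
    rintro ⟨m, k, l⟩
    simp only [e, Function.comp_apply]
    rw [integral_heatTerm hN ha ht hR0 hS0 hω hu, if_pos rfl]
  · rintro ⟨⟨m, k⟩, ⟨n, l⟩⟩ hp
    rw [integral_heatTerm hN ha ht hR0 hS0 hω hu, if_neg]
    rintro rfl
    exact hp ⟨(m, (k, l)), rfl⟩

theorem integral_heatIntegrand_im {N : ℕ} (hN : 1 ≤ N) {a : ℝ} (ha : max 0 (2 - (N : ℝ)) < a)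
    {t : ℝ} (ht : 0 < t) (x y : EuclideanSpace ℝ (Fin N)) :
    (∫ ξ, heatIntegrand N a x y t ξ).im = 0 := by
  obtain ⟨ω, hω, hx⟩ := exists_unit_smul_eq hN x
  obtain ⟨u, hu, hy⟩ := exists_unit_smul_eq hN y
  have h := Complex.hasSum_im (hasSum_heatCoeff hN ha ht hω hu hx hy)
  simp only [Complex.ofReal_im] at h
  exact h.unique hasSum_zero

/-- The weight is real, so exchanging the points conjugates the integrand. With reality of the
integral this yields symmetry. -/
theorem integral_heatIntegrand_conj {N : ℕ} {a t : ℝ} (x y : EuclideanSpace ℝ (Fin N)) :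
    ∫ ξ, heatIntegrand N a y x t ξ = (starRingEnd ℂ) (∫ ξ, heatIntegrand N a x y t ξ) := by
  rw [← integral_conj]
  refine integral_congr_ae (Filter.Eventually.of_forall fun ξ => ?_)
  simp only [heatIntegrand, map_mul, Complex.conj_conj, Complex.conj_ofReal]
  ring

/-- The series for the heat kernel after summing over the Bessel indices. -/
theorem hasSum_integral_heatIntegrand_re {N : ℕ} (hN : 1 ≤ N) {a : ℝ}
    (ha : max 0 (2 - (N : ℝ)) < a) {t : ℝ} (ht : 0 < t) {x y ω u : EuclideanSpace ℝ (Fin N)}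
    (hω : ‖ω‖ = 1) (hu : ‖u‖ = 1) (hx : x = ‖x‖ • ω) (hy : y = ‖y‖ • u) {R S v : ℝ}
    (hR : R = ‖x‖ ^ (a / 2) / a) (hS : S = ‖y‖ ^ (a / 2) / a) (hv : v = R * S * a / t) :
    HasSum (fun m : ℕ => (volume : Measure (EuclideanSpace ℝ (Fin N))).toSphere.real Set.univ *
      Real.Gamma (2 / a * (((N : ℝ) - 2) / 2) + 1) ^ 2 * (1 / a) *
      (t / a) ^ (-(2 / a * (((N : ℝ) - 2) / 2) + 1)) *
      (v ^ (2 / a * (m : ℝ)) * normGegenbauer (((N : ℝ) - 2) / 2) m (inner ℝ ω u)) *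
      (Real.exp (-(R ^ 2 * a / t)) * Real.exp (-(S ^ 2 * a / t)) *
        besselSum (2 / a * m + 2 / a * (((N : ℝ) - 2) / 2)) v))
      (∫ ξ, heatIntegrand N a x y t ξ).re := by
  obtain ⟨h0, h1, hl, hal⟩ := parameters ha
  have h := Complex.hasSum_re (hasSum_heatCoeff hN ha ht hω hu hx hy)
  simp only [Complex.ofReal_re] at h
  rw [← hR, ← hS] at h
  refine h.prod_fiberwise fun m => ?_
  have hμ : -1 < 2 / a * m + 2 / a * (((N : ℝ) - 2) / 2) := by
    have : 0 ≤ 2 / a * (m : ℝ) := by positivity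
    linarith
  have hv2 : v ^ 2 = R ^ 2 * a / t * (S ^ 2 * a / t) := by
    rw [hv]
    field_simp
  simp only [heatCoeff]
  rw [← hv]
  exact (hasSum_weber hμ hv2).mul_left _

/-! ### The Gaussian bound. -/

/-- The series is bounded term by term, with `2 M / a = N - l`; the sum of `1 / (m + 1) ^ 2` goes
into the constant. -/
theorem exists_integral_heatIntegrand_bound {N : ℕ} (hN : 1 ≤ N) {a : ℝ}
    (ha : max 0 (2 - (N : ℝ)) < a) :
    ∃ C : ℝ, 0 < C ∧ ∀ (x y : EuclideanSpace ℝ (Fin N)) (t : ℝ), 0 < t →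
      ‖∫ ξ, heatIntegrand N a x y t ξ‖ ≤
        C * t ^ (-(lam N a + 1)) *
          Real.exp (-(‖x‖ ^ (a / 2) - ‖y‖ ^ (a / 2)) ^ 2 / (a * t)) *
          (1 + ((‖x‖ * ‖y‖) ^ (a / 2) / (a * t)) ^ (2 * bigM N a / a)) := by
  obtain ⟨h0, h1, hl, hal⟩ := parameters ha
  have : Nonempty (Fin N) := ⟨⟨0, hN⟩⟩
  set l := 2 / a * (((N : ℝ) - 2) / 2) with hldef
  have hlam : lam N a = l := by rw [lam, hldef]; field_simp
  have hM : 2 * bigM N a / a = (N : ℝ) - l := by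
    rw [bigM, hldef]
    field_simp
    ring
  obtain ⟨C, hC, hbound⟩ := exists_series_term_bound hN (show 0 < 2 / a by positivity) hl
  set σ := (volume : Measure (EuclideanSpace ℝ (Fin N))).toSphere.real Set.univ with hσ
  have hσ0 : 0 < σ := toSphere_real_univ_pos
  have hG : 0 < Real.Gamma (l + 1) := Real.Gamma_pos_of_pos (by linarith)
  have hZ := summable_one_div_succ_sq
  set Z := ∑' m : ℕ, 1 / ((m : ℝ) + 1) ^ 2 with hZdef
  have hZ0 : 0 < Z := hZ.tsum_pos (fun m => by positivity) 0 (by positivity)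
  set P := σ * Real.Gamma (l + 1) ^ 2 * (1 / a) * (1 / a) ^ (-(l + 1)) with hP
  have hP0 : 0 < P := by positivity
  refine ⟨P * C * Z, by positivity, fun x y t ht => ?_⟩
  obtain ⟨ω, hω, hx⟩ := exists_unit_smul_eq hN x
  obtain ⟨u, hu, hy⟩ := exists_unit_smul_eq hN y
  set R := ‖x‖ ^ (a / 2) / a with hR
  set S := ‖y‖ ^ (a / 2) / a with hS
  have hR0 : 0 ≤ R := by positivity
  have hS0 : 0 ≤ S := by positivity
  have hveq : (‖x‖ * ‖y‖) ^ (a / 2) / (a * t) = R * S * a / t := by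
    rw [Real.mul_rpow (norm_nonneg _) (norm_nonneg _), hR, hS]
    field_simp
  set v := R * S * a / t with hv
  have hv0 : 0 ≤ v := by positivity
  -- The growth `exp (2 v)` of the Bessel factors supplies exactly the cross term of the square.
  have hexp : -(‖x‖ ^ (a / 2) - ‖y‖ ^ (a / 2)) ^ 2 / (a * t) =
      -(R ^ 2 * a / t) + -(S ^ 2 * a / t) + 2 * v := by
    rw [hv, hR, hS]
    field_simp
    ring
  have hta : (t / a) ^ (-(l + 1)) = t ^ (-(l + 1)) * (1 / a) ^ (-(l + 1)) := by
    rw [← Real.mul_rpow ht.le (by positivity), mul_one_div]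
  have hsum := hasSum_integral_heatIntegrand_re hN ha ht hω hu hx hy hR hS hv
  have him := integral_heatIntegrand_im hN ha ht x y
  have hnorm : ‖∫ ξ, heatIntegrand N a x y t ξ‖ = |(∫ ξ, heatIntegrand N a x y t ξ).re| := by
    rw [Complex.abs_re_eq_norm.2 him]
  rw [hnorm, hlam, hM, hveq, hexp, ← hsum.tsum_eq, ← Real.norm_eq_abs]
  have hμ : ∀ m : ℕ, -1 < 2 / a * m + l := fun m => by
    have : 0 ≤ 2 / a * (m : ℝ) := by positivity
    linarith
  refine tsum_of_norm_bounded (g := fun m : ℕ => P * t ^ (-(l + 1)) *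
    (Real.exp (-(R ^ 2 * a / t)) * Real.exp (-(S ^ 2 * a / t))) *
    (C * Real.exp (2 * v) * (1 + v ^ ((N : ℝ) - l))) * (1 / ((m : ℝ) + 1) ^ 2)) ?_ fun m => ?_
  · have := hZ.hasSum.mul_left (P * t ^ (-(l + 1)) *
      (Real.exp (-(R ^ 2 * a / t)) * Real.exp (-(S ^ 2 * a / t))) *
      (C * Real.exp (2 * v) * (1 + v ^ ((N : ℝ) - l))))
    rw [← hZdef] at this
    have e : P * C * Z * t ^ (-(l + 1)) *
        Real.exp (-(R ^ 2 * a / t) + -(S ^ 2 * a / t) + 2 * v) * (1 + v ^ ((N : ℝ) - l)) =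
        P * t ^ (-(l + 1)) * (Real.exp (-(R ^ 2 * a / t)) * Real.exp (-(S ^ 2 * a / t))) *
          (C * Real.exp (2 * v) * (1 + v ^ ((N : ℝ) - l))) * Z := by
      rw [Real.exp_add, Real.exp_add]
      ring
    rw [e]
    exact this
  · have hJ := besselSum_nonneg (hμ m) v
    have hvm : 0 ≤ v ^ (2 / a * (m : ℝ)) := Real.rpow_nonneg hv0 _
    have hgeg := abs_normGegenbauer_le_gegenbauerBound hN hω hu m
    have htp : 0 < t ^ (-(l + 1)) := Real.rpow_pos_of_pos ht _
    have hb := hbound m v hv0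
    rw [← hldef, hta, Real.norm_eq_abs]
    calc _ = P * t ^ (-(l + 1)) *
          (Real.exp (-(R ^ 2 * a / t)) * Real.exp (-(S ^ 2 * a / t))) *
          (v ^ (2 / a * (m : ℝ)) * besselSum (2 / a * m + l) v *
            |normGegenbauer (((N : ℝ) - 2) / 2) m (inner ℝ ω u)|) := by
          have hpos : 0 ≤ P * t ^ (-(l + 1)) *
            (Real.exp (-(R ^ 2 * a / t)) * Real.exp (-(S ^ 2 * a / t))) *
            (v ^ (2 / a * (m : ℝ)) * besselSum (2 / a * m + l) v) := by positivity
          rw [← mul_assoc _ _ |normGegenbauer _ _ _|]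
          refine Eq.trans ?_ (congrArg (· * |_|) (abs_of_nonneg hpos))
          rw [← abs_mul, hP, hσ]
          congr 1
          ring
      _ ≤ P * t ^ (-(l + 1)) *
          (Real.exp (-(R ^ 2 * a / t)) * Real.exp (-(S ^ 2 * a / t))) *
          (v ^ (2 / a * (m : ℝ)) * besselSum (2 / a * m + l) v *
            (2 * ((m : ℝ) + 1) ^ (N - 1) / (m + 1))) := by
          gcongr
          exact hgeg
      _ ≤ P * t ^ (-(l + 1)) *
          (Real.exp (-(R ^ 2 * a / t)) * Real.exp (-(S ^ 2 * a / t))) *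
          (C * Real.exp (2 * v) * (1 + v ^ ((N : ℝ) - l)) * (1 / ((m : ℝ) + 1) ^ 2)) := by
          gcongr
      _ = _ := by ring

end DeformedHeat

end

theorem corollary4p5 (N : ℕ) (hN : 1 ≤ N) (a : ℝ) (ha : max 0 (2 - (N : ℝ)) < a) :
    (∀ (x y : EuclideanSpace ℝ (Fin N)) (t : ℝ), 0 < t →
      Integrable (DeformedHeat.heatIntegrand N a x y t) volume ∧
      (DeformedHeat.heatKernel N a x y t).im = 0 ∧
      DeformedHeat.heatKernel N a x y t = DeformedHeat.heatKernel N a y x t) ∧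
    ∃ C : ℝ, 0 < C ∧ ∀ (x y : EuclideanSpace ℝ (Fin N)) (t : ℝ), 0 < t →
      ‖DeformedHeat.heatKernel N a x y t‖ ≤
        C * t ^ (-(DeformedHeat.lam N a + 1)) *
          Real.exp (-(‖x‖ ^ (a / 2) - ‖y‖ ^ (a / 2)) ^ 2 / (a * t)) *
          (1 + ((‖x‖ * ‖y‖) ^ (a / 2) / (a * t)) ^ (2 * DeformedHeat.bigM N a / a)) := by
  refine ⟨fun x y t ht => ?_, ?_⟩
  · obtain ⟨ω, hω, hx⟩ := DeformedHeat.exists_unit_smul_eq hN x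
    obtain ⟨u, hu, hy⟩ := DeformedHeat.exists_unit_smul_eq hN y
    have him := DeformedHeat.integral_heatIntegrand_im hN ha ht x y
    refine ⟨(DeformedHeat.heatIntegrand_hasSum hN ha ht hω hu hx hy).1, ?_, ?_⟩
    · rw [DeformedHeat.heatKernel, Complex.im_ofReal_mul, him,
        mul_zero]
    · rw [DeformedHeat.heatKernel, DeformedHeat.heatKernel,
        DeformedHeat.integral_heatIntegrand_conj x y, Complex.conj_eq_iff_im.2 him]
  · obtain ⟨C, hC, h⟩ := DeformedHeat.exists_integral_heatIntegrand_bound hN ha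
    -- Adding `1` makes the constant positive without evaluating the normalizing integral.
    refine ⟨(|DeformedHeat.cConst N a| + 1) * C, by positivity, fun x y t ht => ?_⟩
    rw [DeformedHeat.heatKernel, norm_mul, Complex.norm_real, Real.norm_eq_abs]
    calc _ ≤ (|DeformedHeat.cConst N a| + 1) * ‖∫ ξ, DeformedHeat.heatIntegrand N a x y t ξ‖ := by
          gcongr
          linarith
      _ ≤ _ := by
          rw [mul_assoc, mul_assoc, mul_assoc]
          refine mul_le_mul_of_nonneg_left ?_ (by positivity)
          have := h x y t ht
          rwa [mul_assoc, mul_assoc] at this
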